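/- Let $n\ge 1$, $0<\gamma<1$, $T>0$, and let $u\in C([0,T];L^2(\mathbb{R}^n))\cap C((0,T];H^2(\mathbb{R}^n))$ be a weak solution of the final value problem $$\partial_t^\gamma u=\Delta u \ \text{ in } L^2(\mathbb{R}^n) \text{ for every } t\in(0,T),\qquad u(\cdot,T)=g,$$ where $\partial_t^\gamma u(t)=\frac1{\Gamma(1-\gamma)}\int_0^t\frac{u'(r)}{(t-r)^\gamma}\,dr$ is the Caputo derivative. Write $\widehat f(\xi)=(2\pi)^{-n/2}\int f(x)e^{-ix\cdot\xi}\,dx$ for the Fourier transform (extended to $L^2$), $\|f\|_{H^r}=\|(1+|\xi|^2)^{r/2}\widehat f\|_{L^2}$ for $r\ge0$, and $E_{\gamma,1}(z)=\sum_{k\ge0}z^k/\Gamma(\gamma k+1)$ for the Mittag-Leffler function. Let $\tau>0$, $s>0$, and let $\varphi$ be the kernel with $\widehat\varphi(\xi)=(2\pi)^{-n/2}e^{-\tau|\xi|^s}$. For $\alpha>0$ put $\varphi_\alpha(x)=\alpha^{-n}\varphi(x/\alpha)$ and $M_\alpha f=\varphi_\alpha\star f$. For noisy data $g^\delta\in L^2(\mathbb{R}^n)$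 let $u_\alpha^\delta$ be the regularized solution, defined by $$\widehat{u_\alpha^\delta}(\xi,t)=\frac{E_{\gamma,1}(-|\xi|^2t^\gamma)}{E_{\gamma,1}(-|\xi|^2T^\gamma)}\,e^{-\tau(\alpha|\xi|)^s}\,\widehat{g^\delta}(\xi),\qquad t\in[0,T].$$ Let $p>0$, $\theta>1$ and $p+2\le s$. Then there is a constant $C>0$, depending only on $n,\gamma,T,\tau,s,p,\theta$ (in particular independent of $\delta$, $E$, $t$, $u$ and $g^\delta$), such that the following holds. Suppose that $E>0$, $u(\cdot,0)\in H^p(\mathbb{R}^n)$ with $\|u(\cdot,0)\|_{H^p}\le E$, $\|g-g^\delta\|_{L^2}\le\delta$, $0<\theta\delta<\|g^\delta\|_{L^2}$, and that the parameter $\alpha=\alpha(\delta,g^\delta)>0$ satisfies the Morozov-type a-posteriori rule $$\|g^\delta-M_\alpha g^\delta\|_{L^2}=\theta\delta .$$ Then $u_\alpha^\delta(\cdot,t)$ is a well-defined element of $L^2(\mathbb{R}^n)$ for every $t\in[0,T]$, and $$\|u(\cdot,t)-u_{\alpha}^\delta(\cdot,t)\|_{H^l}\le C\,E^{\frac{2+l}{p+2}}\,\delta^{\frac{p-l}{p+2}}\qquad\text{for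 all } l\in[0,p] \text{ and all } t\in[0,T].$$ In particular ($l=0$, $t=0$) the initial distribution is recovered in $L^2$ at the rate $E^{\frac{2}{p+2}}\delta^{\frac{p}{p+2}}$. -/

import Mathlib

open MeasureTheory Set Filter Topology
open scoped FourierTransform SchwartzMap Laplacian ENNReal Convolution

namespace FracDiffusion

/-- The space `ℝⁿ` with its Euclidean norm. -/
abbrev Rn (n : ℕ) : Type := EuclideanSpace ℝ (Fin n)

/-- The space `L²(ℝⁿ)` (complex valued). -/
abbrev L2 (n : ℕ) : Type := Lp ℂ 2 (volume : Measure (Rn n))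

/-- The length `|ξ|` of the angular frequency `ξ = 2πη`, as a function of the ordinary frequency
`η`. The Fourier transform `𝓕` of Mathlib is `𝓕 f η = ∫ f(x) exp(-2πi x·η) dx`; it is an isometry
of `L²`, and it is related to the unitary transform in angular frequency,
`f̂(ξ) = (2π)^(-n/2) ∫ f(x) exp(-i x·ξ) dx`, by `f̂(2πη) = (2π)^(-n/2) 𝓕 f η`. So the operator with
symbol `m(|ξ|)` with respect to `f ↦ f̂` has the symbol `m(angFreq η)` with respect to `𝓕`. -/
noncomputable def angFreq {n : ℕ} (η : Rn n) : ℝ := 2 * Real.pi * ‖η‖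

/-- The Mittag-Leffler function `E_{γ,1}(z) = ∑ₖ zᵏ / Γ(γ k + 1)`, for a real argument. -/
noncomputable def mittagLeffler (γ z : ℝ) : ℝ :=
  ∑' k : ℕ, z ^ k / Real.Gamma (γ * k + 1)

/-- The norm of `Hʳ(ℝⁿ)`, `‖f‖² = ∫ (1 + |ξ|²)ʳ |f̂(ξ)|² dξ`, for `f ∈ L²` and `r ≥ 0`; it is `∞`
exactly when `f ∉ Hʳ(ℝⁿ)`. -/
noncomputable def sobolevENorm {n : ℕ} (r : ℝ) (f : L2 n) : ℝ≥0∞ :=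
  eLpNorm (fun η : Rn n => (((1 + angFreq η ^ 2) ^ (r / 2) : ℝ) : ℂ) * (𝓕 f : L2 n) η) 2 volume

/-- The Caputo derivative of order `γ ∈ (0,1)`,
`(1 / Γ(1-γ)) ∫₀ᵗ u'(r) / (t-r)^γ dr`, of a function of time with values in a Banach space. -/
noncomputable def caputoDeriv {X : Type*} [NormedAddCommGroup X] [NormedSpace ℝ X]
    (γ : ℝ) (u : ℝ → X) (t : ℝ) : X :=
  (Real.Gamma (1 - γ))⁻¹ • ∫ r in (0 : ℝ)..t, ((t - r) ^ γ)⁻¹ • deriv u r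

/-- `u` is a weak solution of the final value problem `∂^γ u / ∂t^γ = Δ u` on `ℝⁿ × (0,T)`,
`u(·,T) = g`: it lies in `C([0,T], L²) ∩ C((0,T], H²)`, and for every `t ∈ (0,T)` its Caputo
derivative exists and equals `Δ u(·,t)` in `L²`, where `Δ` is the distributional Laplacian. -/
structure IsWeakSolution {n : ℕ} (γ T : ℝ) (g : L2 n) (u : ℝ → L2 n) : Prop where
  continuousOn_L2 : ContinuousOn u (Icc 0 T)
  mem_H2 : ∀ t ∈ Ioc 0 T, sobolevENorm 2 (u t) < ∞
  continuousOn_H2 : ∀ t ∈ Ioc 0 T,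
    Tendsto (fun r => sobolevENorm 2 (u r - u t)) (𝓝[Ioc 0 T] t) (𝓝 0)
  differentiableAt : ∀ t ∈ Ioo 0 T, DifferentiableAt ℝ u t
  integrable : ∀ t ∈ Ioo 0 T,
    IntervalIntegrable (fun r => ((t - r) ^ γ)⁻¹ • deriv u r) volume 0 t
  equation : ∀ t ∈ Ioo 0 T,
    ((caputoDeriv γ u t : L2 n) : 𝓢'(Rn n, ℂ)) = Δ ((u t : L2 n) : 𝓢'(Rn n, ℂ))
  final : u T = g

/-- The mollifier kernel `φ` on `ℝⁿ` with `φ̂(ξ) = (2π)^(-n/2) exp(-τ |ξ|^s)`, that is,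
`φ(x) = (2π)^(-n) ∫ exp(i x·ξ) exp(-τ |ξ|^s) dξ`. -/
noncomputable def kernel {n : ℕ} (τ s : ℝ) : Rn n → ℂ :=
  𝓕⁻ (fun η : Rn n => ((Real.exp (-τ * angFreq η ^ s) : ℝ) : ℂ))

/-- The rescaled kernel `φ_α(x) = α^(-n) φ(x / α)`. -/
noncomputable def scaledKernel {n : ℕ} (τ s α : ℝ) (x : Rn n) : ℂ :=
  (((α ^ n)⁻¹ : ℝ) : ℂ) * kernel τ s (α⁻¹ • x)

/-- The mollifier operator `M_α f = φ_α ⋆ f`. -/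
noncomputable def mollify {n : ℕ} (τ s α : ℝ) (f : L2 n) : Rn n → ℂ :=
  scaledKernel τ s α ⋆[ContinuousLinearMap.mul ℂ ℂ, volume] (f : Rn n → ℂ)

/-- The Fourier transform of the regularized solution `u_α^δ(·,t)` for the data `g^δ`:
`(E_{γ,1}(-|ξ|² t^γ) / E_{γ,1}(-|ξ|² T^γ)) exp(-τ (α|ξ|)^s) 𝓕 g^δ`; the exponential is
`(2π)^(n/2) φ̂(αξ)`. -/
noncomputable def regularizedHat {n : ℕ} (γ T τ s α : ℝ) (gδ : L2 n) (t : ℝ) (η : Rn n) : ℂ :=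
  ((mittagLeffler γ (-(angFreq η ^ 2) * t ^ γ) / mittagLeffler γ (-(angFreq η ^ 2) * T ^ γ) *
    Real.exp (-τ * (α * angFreq η) ^ s) : ℝ) : ℂ) * (𝓕 gδ : L2 n) η

open Classical in
/-- The regularized solution `u_α^δ(·,t) ∈ L²(ℝⁿ)`, the element of `L²` whose Fourier transform is
`regularizedHat` (with the value `0` in the case, which has to be excluded by proof where it
matters, that `regularizedHat` is not square integrable). -/
noncomputable def regularizedSolution {n : ℕ} (γ T τ s α : ℝ) (gδ : L2 n) (t : ℝ) : L2 n :=
  if h : MemLp (regularizedHat γ T τ s α gδ t) 2 (volume : Measure (Rn n)) then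
    (𝓕⁻ (h.toLp _ : L2 n) : L2 n)
  else 0

end FracDiffusion

namespace FracDiffusion

/-! ### Riemann-Liouville kernels -/

/-! On the Fourier side the problem is diagonal. Write `e_t` for the symbol E_{γ,1}(-|ξ|²t^γ), `m`
for exp(-τ(α|ξ|)^s) and v = u(·,0). Then û(t) = e_t v̂ (`fourier_weakSolution`), M_α is
multiplication by `m` (`eLpNorm_sub_mollify`), and e_T lies between multiples of 1/(1+|ξ|²)
(`mittagLeffler_neg_bounds`). Inverting e_T therefore loses exactly two derivatives.

The error is bounded at two ends of the Sobolev scale. In H⁻² it is (e_t/e_T)(ĝ - m ĝδ), and the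
rule makes ĝ - m ĝδ at most (1+θ)δ (`eLpNorm_error_neg_two_le`). In Hᵖ it is (1-m)e_t v̂ plus
amplified noise of size (1 + α^(-(p+2)))δ (`eLpNorm_error_le`). The rule also prevents α from being
too small: the residual θδ is at most δ plus the residual of the exact data, which is O(α^(p+2) E)
because p+2 ≤ s (`noise_le_of_morozov`, `one_sub_mollSymbol_mul_mlSymbol_le`). So the Hᵖ error is
O(E), and Hölder interpolation between O(E) and O(δ) gives the rate.

The representation of u is obtained by cutting off high frequencies, where the Laplacian becomes
bounded. The Caputo equation is then equivalent to a Volterra equation whose Picard iteration is the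
Mittag-Leffler series (`IsCaputoSolution.tendsto_sum`). The bounds on e_T follow from convolution
identities once z(t) = t^(γ-1)E_{γ,γ}(-t^γ) is known to be positive (`mlSeries_self_pos`). -/

/-- The kernel `t^(b-1) / Γ(b)` of the Riemann-Liouville integral of order `b`. -/
noncomputable def fracPow (b t : ℝ) : ℝ := t ^ (b - 1) / Real.Gamma b

lemma fracPow_pos {b t : ℝ} (hb : 0 < b) (ht : 0 < t) : 0 < fracPow b t :=
  div_pos (Real.rpow_pos_of_pos ht _) (Real.Gamma_pos_of_pos hb)

lemma fracPow_nonneg {b t : ℝ} (hb : 0 < b) (ht : 0 ≤ t) : 0 ≤ fracPow b t :=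
  div_nonneg (Real.rpow_nonneg ht _) (Real.Gamma_pos_of_pos hb).le

@[simp] lemma fracPow_one (t : ℝ) : fracPow 1 t = 1 := by simp [fracPow]

lemma continuous_fracPow {b : ℝ} (hb : 1 ≤ b) : Continuous (fracPow b) := by
  unfold fracPow
  exact (Real.continuous_rpow_const (by linarith)).div_const _

@[fun_prop]
lemma measurable_fracPow (b : ℝ) : Measurable (fracPow b) := by
  unfold fracPow
  fun_prop

/-- The semigroup law of the Riemann-Liouville kernels. -/
lemma integral_fracPow_mul_fracPow {a b t : ℝ} (ha : 0 < a) (hb : 0 < b) (ht : 0 < t) :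
    ∫ s in (0 : ℝ)..t, fracPow a (t - s) * fracPow b s = fracPow (a + b) t := by
  have h1 := Complex.betaIntegral_scaled (b : ℂ) (a : ℂ) ht
  rw [Complex.betaIntegral_eq_Gamma_mul_div _ _ (by simpa) (by simpa)] at h1
  have h2 : ∫ s in (0 : ℝ)..t, ((s ^ (b - 1) * (t - s) ^ (a - 1) : ℝ) : ℂ) =
      ((t ^ (b + a - 1) * (Real.Gamma b * Real.Gamma a / Real.Gamma (b + a)) : ℝ) : ℂ) := by
    rw [← Complex.ofReal_add, Complex.Gamma_ofReal, Complex.Gamma_ofReal, Complex.Gamma_ofReal]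
      at h1
    push_cast [Complex.ofReal_cpow ht.le]
    rw [← Complex.ofReal_add, ← h1]
    apply intervalIntegral.integral_congr
    intro s hs
    rw [uIcc_of_le ht.le] at hs
    dsimp only
    rw [Complex.ofReal_cpow hs.1, Complex.ofReal_cpow (sub_nonneg.2 hs.2)]
    push_cast
    rfl
  rw [intervalIntegral.integral_ofReal, Complex.ofReal_inj] at h2
  have hga := (Real.Gamma_pos_of_pos ha).ne'
  have hgb := (Real.Gamma_pos_of_pos hb).ne'
  have h3 : ∀ s, fracPow a (t - s) * fracPow b s =
      (Real.Gamma a * Real.Gamma b)⁻¹ * (s ^ (b - 1) * (t - s) ^ (a - 1)) := by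
    intro s
    unfold fracPow
    field_simp
  simp_rw [h3]
  rw [intervalIntegral.integral_const_mul, h2, fracPow, add_comm b a]
  field_simp

/-- A Bochner integral with nonzero value forces integrability, so the semigroup law already
contains it. -/
lemma intervalIntegrable_fracPow_mul_fracPow {a b t : ℝ} (ha : 0 < a) (hb : 0 < b) (ht : 0 < t) :
    IntervalIntegrable (fun s => fracPow a (t - s) * fracPow b s) volume 0 t := by
  apply intervalIntegral.intervalIntegrable_of_integral_ne_zero
  rw [integral_fracPow_mul_fracPow ha hb ht]
  exact (fracPow_pos (by linarith) ht).ne'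

lemma intervalIntegrable_fracPow_sub {a t : ℝ} (ha : 0 < a) (ht : 0 < t) :
    IntervalIntegrable (fun s => fracPow a (t - s)) volume 0 t := by
  simpa using intervalIntegrable_fracPow_mul_fracPow ha one_pos ht

lemma integral_fracPow_sub {a t : ℝ} (ha : 0 < a) (ht : 0 < t) :
    ∫ s in (0 : ℝ)..t, fracPow a (t - s) = fracPow (a + 1) t := by
  simpa using integral_fracPow_mul_fracPow ha one_pos ht

/-- The Gamma function grows faster than any exponential function. -/
lemma exp_mul_rpow_le_Gamma {a R : ℝ} (ha : 1 ≤ a) (hR : 0 < R) :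
    Real.exp (-(R + 1)) * R ^ (a - 1) ≤ Real.Gamma a := by
  have ha0 : 0 < a := by linarith
  rw [Real.Gamma_eq_integral ha0]
  have hint := Real.GammaIntegral_convergent ha0
  have hsub : Ioc R (R + 1) ⊆ Ioi (0 : ℝ) := fun x hx => hR.trans hx.1
  -- Only the part of Euler's integral over (R, R+1] is kept.
  calc Real.exp (-(R + 1)) * R ^ (a - 1)
      = ∫ x in Ioc R (R + 1), Real.exp (-(R + 1)) * R ^ (a - 1) := by simp
    _ ≤ ∫ x in Ioc R (R + 1), Real.exp (-x) * x ^ (a - 1) := by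
        apply setIntegral_mono_on (integrableOn_const (by simp)) (hint.mono_set hsub) measurableSet_Ioc
        intro x hx
        have := hx.1
        have := hx.2
        gcongr
    _ ≤ _ := by
        apply setIntegral_mono_set hint _ hsub.eventuallyLE
        filter_upwards [ae_restrict_mem measurableSet_Ioi] with x hx
        have : (0 : ℝ) < x := hx
        positivity

lemma summable_pow_div_Gamma {γ b : ℝ} (hγ : 0 < γ) (x : ℝ) :
    Summable fun k : ℕ => x ^ k / Real.Gamma (γ * k + b) := by
  -- Chosen so that |x| / R^γ ≤ 1/2, which gives a geometric majorant.
  set R : ℝ := (2 * |x| + 1) ^ γ⁻¹ with hRdef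
  have hR : 0 < R := by positivity
  have hRγ : R ^ γ = 2 * |x| + 1 := by
    rw [hRdef, ← Real.rpow_mul (by positivity), inv_mul_cancel₀ hγ.ne', Real.rpow_one]
  have hev : ∀ᶠ k : ℕ in atTop, 1 ≤ γ * k + b := by
    have : Tendsto (fun k : ℕ => γ * (k : ℝ) + b) atTop atTop :=
      tendsto_atTop_add_const_right _ _ (tendsto_natCast_atTop_atTop.const_mul_atTop hγ)
    exact this.eventually_ge_atTop 1
  have hg : Summable fun k : ℕ =>
      (Real.exp (R + 1) * R ^ (1 - b)) * (1 / 2 : ℝ) ^ k :=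
    (summable_geometric_two).mul_left _
  refine Summable.of_norm_bounded_eventually_nat hg ?_
  filter_upwards [hev] with k hk
  have h1 := exp_mul_rpow_le_Gamma hk hR
  have h0 : 0 < Real.exp (-(R + 1)) * R ^ (γ * k + b - 1) := by positivity
  rw [norm_div, norm_pow, Real.norm_eq_abs, Real.norm_eq_abs, abs_of_pos (h0.trans_le h1)]
  calc |x| ^ k / Real.Gamma (γ * k + b)
      ≤ |x| ^ k / (Real.exp (-(R + 1)) * R ^ (γ * k + b - 1)) := by gcongr
    _ = (Real.exp (R + 1) * R ^ (1 - b)) * (|x| / R ^ γ) ^ k := by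
        rw [show γ * k + b - 1 = γ * k - (1 - b) by ring, Real.rpow_sub hR, Real.rpow_mul hR.le,
          Real.rpow_natCast, Real.exp_neg, div_pow]
        field_simp
    _ ≤ _ := by
        refine mul_le_mul_of_nonneg_left (pow_le_pow_left₀ (by positivity) ?_ _) (by positivity)
        rw [hRγ, div_le_div_iff₀ (by positivity) (by norm_num)]
        linarith

/-! ### Mittag-Leffler functions -/

/-- The function `∑ₖ (-1)ᵏ t^(γ k + b - 1) / Γ(γ k + b) = t^(b-1) E_{γ,b}(-t^γ)`. -/
noncomputable def mlSeries (γ b t : ℝ) : ℝ := ∑' k : ℕ, (-1) ^ k * fracPow (γ * k + b) t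

/-- The two-parameter function `E_{γ,b}(-x)`. -/
noncomputable def mlEntire (γ b x : ℝ) : ℝ := ∑' k : ℕ, (-x) ^ k / Real.Gamma (γ * k + b)

lemma fracPow_eq_mul {γ b t : ℝ} (ht : 0 < t) (k : ℕ) :
    fracPow (γ * k + b) t = t ^ (b - 1) * ((t ^ γ) ^ k / Real.Gamma (γ * k + b)) := by
  rw [fracPow, add_sub_assoc, Real.rpow_add ht, Real.rpow_mul ht.le, Real.rpow_natCast]
  ring

lemma summable_fracPow {γ b t : ℝ} (hγ : 0 < γ) (ht : 0 < t) :
    Summable fun k : ℕ => fracPow (γ * k + b) t := by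
  simp_rw [fracPow_eq_mul ht]
  exact (summable_pow_div_Gamma hγ _).mul_left _

lemma summable_mlSeries {γ b t : ℝ} (hγ : 0 < γ) (hb : 0 < b) (ht : 0 < t) :
    Summable fun k : ℕ => (-1) ^ k * fracPow (γ * k + b) t := by
  refine Summable.of_norm_bounded (summable_fracPow (b := b) hγ ht) fun k => ?_
  rw [norm_mul, norm_pow, norm_neg, norm_one, one_pow, one_mul, Real.norm_eq_abs,
    abs_of_nonneg (fracPow_nonneg (by positivity) ht.le)]

lemma mlSeries_eq {γ b t : ℝ} (ht : 0 < t) :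
    mlSeries γ b t = t ^ (b - 1) * mlEntire γ b (t ^ γ) := by
  rw [mlSeries, mlEntire, ← tsum_mul_left]
  congr 1
  ext k
  rw [fracPow_eq_mul ht, neg_pow (t ^ γ)]
  ring

lemma mlEntire_one (γ x : ℝ) : mlEntire γ 1 x = mittagLeffler γ (-x) := rfl

lemma mlEntire_zero (γ b : ℝ) : mlEntire γ b 0 = (Real.Gamma b)⁻¹ := by
  rw [mlEntire, tsum_eq_single 0]
  · simp
  · intro k hk
    simp [hk]

lemma differentiable_mlEntire {γ : ℝ} (hγ : 0 < γ) (b : ℝ) : Differentiable ℝ (mlEntire γ b) := by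
  set c : ℕ → ℝ := fun k => (Real.Gamma (γ * k + b))⁻¹
  set P := FormalMultilinearSeries.ofScalars ℝ c
  have hr : P.radius = ⊤ := by
    apply FormalMultilinearSeries.radius_eq_top_of_summable_norm
    intro r
    have := (summable_pow_div_Gamma (b := b) hγ (r : ℝ)).norm
    refine this.congr fun k => ?_
    rw [FormalMultilinearSeries.ofScalars_norm, norm_div, norm_pow, NNReal.norm_eq, norm_inv, div_eq_inv_mul]
  have hd : Differentiable ℝ P.sum := by
    have := (P.hasFPowerSeriesOnBall (by simp [hr])).differentiableOn
    rw [hr] at this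
    intro x
    exact (this x (by simp)).differentiableAt (Metric.isOpen_eball.mem_nhds (by simp))
  have : mlEntire γ b = fun x => P.sum (-x) := by
    ext x
    have := congrFun (FormalMultilinearSeries.ofScalarsSum_eq_tsum (E := ℝ) c) (-x)
    rw [FormalMultilinearSeries.ofScalarsSum] at this
    rw [this, mlEntire]
    congr 1
    ext k
    simp [c, div_eq_inv_mul]
  rw [this]
  exact hd.comp differentiable_neg

/-- The Riemann-Liouville integral of a Mittag-Leffler function. -/
lemma integral_fracPow_mul_mlSeries {γ a b t : ℝ} (hγ : 0 < γ) (ha : 0 < a) (hb : 0 < b) (ht : 0 < t) :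
    ∫ s in (0 : ℝ)..t, fracPow a (t - s) * mlSeries γ b s = mlSeries γ (a + b) t := by
  have hpos : ∀ k : ℕ, 0 < γ * k + b := fun k => by positivity
  have hi := fun k : ℕ => (intervalIntegrable_fracPow_mul_fracPow ha (hpos k) ht).const_mul
    ((-1 : ℝ) ^ k)
  have hval := fun k : ℕ => integral_fracPow_mul_fracPow ha (hpos k) ht
  simp only [intervalIntegrable_iff_integrableOn_Ioc_of_le ht.le, IntegrableOn] at hi
  simp only [intervalIntegral.integral_of_le ht.le] at hval ⊢
  have hs : Summable fun k : ℕ => ∫ s in Ioc 0 t,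
      ‖(-1 : ℝ) ^ k * (fracPow a (t - s) * fracPow (γ * k + b) s)‖ := by
    refine (summable_fracPow (b := a + b) hγ ht).congr fun k => ?_
    rw [show γ * k + (a + b) = a + (γ * k + b) by ring, ← hval k]
    apply setIntegral_congr_fun measurableSet_Ioc
    intro s hs
    have h1 := fracPow_nonneg ha (sub_nonneg.2 hs.2)
    have h2 := fracPow_nonneg (hpos k) hs.1.le
    simp [abs_of_nonneg h1, abs_of_nonneg h2]
  have := (hasSum_integral_of_summable_integral_norm hi hs).tsum_eq
  rw [mlSeries]
  calc _ = ∫ s in Ioc 0 t, ∑' k : ℕ,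
        (-1 : ℝ) ^ k * (fracPow a (t - s) * fracPow (γ * k + b) s) := by
        congr 1
        ext s
        rw [mlSeries, ← tsum_mul_left]
        congr 1
        ext k
        ring
    _ = _ := by
        rw [← this]
        congr 1
        ext k
        rw [integral_const_mul, hval, show γ * k + (a + b) = a + (γ * k + b) by ring]

/-- Splitting off the term k = 0 shifts the series by γ and flips its sign. -/
lemma mlSeries_add_eq {γ b t : ℝ} (hγ : 0 < γ) (hb : 0 < b) (ht : 0 < t) :
    mlSeries γ (γ + b) t = fracPow b t - mlSeries γ b t := by
  have h := (summable_mlSeries hγ hb ht).tsum_eq_zero_add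
  rw [mlSeries, mlSeries, h]
  simp only [pow_zero, Nat.cast_zero, mul_zero, zero_add, one_mul, sub_add_cancel_left]
  rw [← tsum_neg]
  congr 1
  ext k
  rw [pow_succ]
  push_cast
  rw [show γ * (k + 1) + b = γ * k + (γ + b) by ring]
  ring

end FracDiffusion

namespace FracDiffusion

/-! ### Positivity and two-sided bounds for Mittag-Leffler functions -/

lemma differentiableAt_mlSeries {γ b t : ℝ} (hγ : 0 < γ) (ht : 0 < t) :
    DifferentiableAt ℝ (mlSeries γ b) t := by
  have : mlSeries γ b =ᶠ[𝓝 t] fun t => t ^ (b - 1) * mlEntire γ b (t ^ γ) := by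
    filter_upwards [Ioi_mem_nhds ht] with s hs using mlSeries_eq hs
  rw [this.differentiableAt_iff]
  have h1 : DifferentiableAt ℝ (fun t : ℝ => t ^ γ) t :=
    (Real.hasDerivAt_rpow_const (Or.inl ht.ne')).differentiableAt
  have h2 : DifferentiableAt ℝ (fun t : ℝ => t ^ (b - 1)) t :=
    (Real.hasDerivAt_rpow_const (Or.inl ht.ne')).differentiableAt
  exact h2.mul ((differentiable_mlEntire hγ b _).comp t h1)

/-- Near 0 the series is the power kernel of order b times a continuous function, so it is no more
singular than that kernel. -/
lemma intervalIntegrable_fracPow_mul_mlSeries {γ a b t : ℝ} (hγ : 0 < γ) (ha : 0 < a) (hb : 0 < b)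
    (ht : 0 < t) : IntervalIntegrable (fun s => fracPow a (t - s) * mlSeries γ b s) volume 0 t := by
  have hc : ContinuousOn (fun s : ℝ => Real.Gamma b * mlEntire γ b (s ^ γ)) (uIcc 0 t) :=
    (continuous_const.mul ((differentiable_mlEntire hγ b).continuous.comp
      (Real.continuous_rpow_const hγ.le))).continuousOn
  refine ((intervalIntegrable_fracPow_mul_fracPow ha hb ht).mul_continuousOn hc).congr ?_
  intro s hs
  rw [uIoc_of_le ht.le] at hs
  have := (Real.Gamma_pos_of_pos hb).ne'
  dsimp only
  rw [mlSeries_eq hs.1, fracPow, fracPow]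
  field_simp

lemma intervalIntegrable_mlSeries {γ b t : ℝ} (hγ : 0 < γ) (hb : 0 < b) (ht : 0 < t) :
    IntervalIntegrable (mlSeries γ b) volume 0 t := by
  simpa using intervalIntegrable_fracPow_mul_mlSeries hγ one_pos hb ht

/-- Integrated form of y' = -z with y = `mlSeries γ 1` and z = `mlSeries γ γ`; it avoids termwise
differentiation. -/
lemma integral_mlSeries_self {γ t : ℝ} (hγ : 0 < γ) (ht : 0 < t) :
    ∫ s in (0 : ℝ)..t, mlSeries γ γ s = 1 - mlSeries γ 1 t := by
  have h := integral_fracPow_mul_mlSeries hγ one_pos hγ ht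
  rw [add_comm, mlSeries_add_eq hγ one_pos ht] at h
  simpa using h

/-- Bernoulli's inequality (1-u)^(-γ) ≥ 1 + γu with u = h/x, that is, the tangent-line bound for a
convex kernel. -/
lemma fracPow_sub_le {γ x h : ℝ} (hγ0 : 0 < γ) (hγ1 : γ < 1) (hh : 0 < h) (hx : h < x) :
    γ / Real.Gamma (1 - γ) * x ^ (-γ - 1) * h ≤ fracPow (1 - γ) (x - h) - fracPow (1 - γ) x := by
  have hG := Real.Gamma_pos_of_pos (sub_pos.2 hγ1)
  have hx0 : 0 < x := hh.trans hx
  have h1 : 0 < 1 - h / x := by rw [sub_pos, div_lt_one hx0]; exact hx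
  have h2 : (1 + γ * (h / x)) ≤ (1 - h / x) ^ (-γ) := by
    rw [Real.rpow_def_of_pos h1]
    have := Real.log_le_sub_one_of_pos h1
    have h4 := Real.add_one_le_exp (Real.log (1 - h / x) * -γ)
    nlinarith
  have h3 : (x - h) ^ (-γ) = x ^ (-γ) * (1 - h / x) ^ (-γ) := by
    rw [← Real.mul_rpow hx0.le h1.le]
    congr 1
    field_simp
  rw [fracPow, fracPow, ← sub_div, sub_sub_cancel_left, h3, Real.rpow_sub_one hx0.ne']
  rw [show γ / Real.Gamma (1 - γ) * (x ^ (-γ) / x) * h =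
    (x ^ (-γ) * (γ * (h / x))) / Real.Gamma (1 - γ) by ring]
  gcongr
  have := Real.rpow_pos_of_pos hx0 (-γ)
  nlinarith

lemma fracPow_antitone {γ x y : ℝ} (hγ0 : 0 < γ) (hγ1 : γ < 1) (hx : 0 < x) (hxy : x ≤ y) :
    fracPow (1 - γ) y ≤ fracPow (1 - γ) x := by
  have hG := Real.Gamma_pos_of_pos (sub_pos.2 hγ1)
  have : 1 - γ - 1 ≤ 0 := by linarith
  exact div_le_div_of_nonneg_right (Real.rpow_le_rpow_of_nonpos hx hxy this) hG.le

/-- The decrement of `fracPow (1 - γ) * z = mlSeries γ 1` before a zero `t` of the positive function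
`z = mlSeries γ γ`. -/
lemma mul_one_sub_mlSeries_le {γ t h L : ℝ} (hγ0 : 0 < γ) (hγ1 : γ < 1) (hh : 0 < h) (ht : h < t)
    (hpos : ∀ r ∈ Ioo 0 t, 0 < mlSeries γ γ r)
    (hLip : ∀ r ∈ Ioc (t - h) t, mlSeries γ γ r ≤ L * h) :
    γ / Real.Gamma (1 - γ) * t ^ (-γ - 1) * (1 - mlSeries γ 1 (t - h)) ≤
      L * h + L * fracPow (2 - γ) h := by
  have hG := Real.Gamma_pos_of_pos (sub_pos.2 hγ1)
  have hγ' : 0 < 1 - γ := by linarith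
  have ht0 : 0 < t := hh.trans ht
  have hth : 0 < t - h := by linarith
  have hsub1 : uIcc 0 (t - h) ⊆ uIcc 0 t := by
    rw [uIcc_of_le hth.le, uIcc_of_le ht0.le]; exact Icc_subset_Icc_right (by linarith)
  have hsub2 : uIcc (t - h) t ⊆ uIcc 0 t := by
    rw [uIcc_of_le (by linarith : t - h ≤ t), uIcc_of_le ht0.le]
    exact Icc_subset_Icc_left (by linarith)
  have e1 := integral_fracPow_mul_mlSeries hγ0 hγ' hγ0 ht0
  have e2 := integral_fracPow_mul_mlSeries hγ0 hγ' hγ0 hth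
  have e3 := integral_mlSeries_self hγ0 ht0
  have e4 := integral_mlSeries_self hγ0 hth
  have i1 := intervalIntegrable_fracPow_mul_mlSeries hγ0 hγ' hγ0 ht0
  have i2 := intervalIntegrable_fracPow_mul_mlSeries hγ0 hγ' hγ0 hth
  have i3 := intervalIntegrable_mlSeries hγ0 hγ0 ht0
  rw [sub_add_cancel] at e1 e2
  rw [← intervalIntegral.integral_add_adjacent_intervals (i1.mono_set hsub1) (i1.mono_set hsub2)]
    at e1
  rw [← intervalIntegral.integral_add_adjacent_intervals (i3.mono_set hsub1) (i3.mono_set hsub2),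
    e4] at e3
  have b1 : ∫ r in (t - h)..t, mlSeries γ γ r ≤ L * h * h := by
    have := intervalIntegral.integral_mono_on_of_le_Ioo (by linarith : t - h ≤ t)
      (i3.mono_set hsub2) (intervalIntegrable_const (c := L * h)) fun r hr => hLip r ⟨hr.1, hr.2.le⟩
    simp at this
    linarith
  have hl : IntervalIntegrable (fun r => fracPow (1 - γ) (t - r)) volume 0 t :=
    intervalIntegrable_fracPow_sub hγ' ht0
  have b2 : ∫ r in (t - h)..t, fracPow (1 - γ) (t - r) * mlSeries γ γ r ≤
      L * h * fracPow (2 - γ) h := by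
    have h1 := intervalIntegral.integral_mono_on_of_le_Ioo (by linarith : t - h ≤ t)
      (i1.mono_set hsub2) ((hl.mono_set hsub2).mul_const (L * h)) fun r hr => by
        have := fracPow_nonneg hγ' (sub_nonneg.2 hr.2.le)
        exact mul_le_mul_of_nonneg_left (hLip r ⟨hr.1, hr.2.le⟩) this
    have h2 := integral_fracPow_sub hγ' hh
    rw [intervalIntegral.integral_comp_sub_left (fracPow (1 - γ))] at h2
    rw [intervalIntegral.integral_mul_const,
      intervalIntegral.integral_comp_sub_left (fracPow (1 - γ))] at h1
    simp only [sub_self, sub_zero, sub_sub_cancel] at h1 h2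
    rw [h2, show 1 - γ + 1 = 2 - γ by ring] at h1
    linarith
  have b3 : γ / Real.Gamma (1 - γ) * t ^ (-γ - 1) * h * (1 - mlSeries γ 1 (t - h)) ≤
      (∫ r in (0 : ℝ)..(t - h), fracPow (1 - γ) (t - h - r) * mlSeries γ γ r) -
      ∫ r in (0 : ℝ)..(t - h), fracPow (1 - γ) (t - r) * mlSeries γ γ r := by
    rw [← intervalIntegral.integral_sub i2 (i1.mono_set hsub1), ← e4,
      ← intervalIntegral.integral_const_mul]
    apply intervalIntegral.integral_mono_on_of_le_Ioo hth.le
      ((i3.mono_set hsub1).const_mul _) (i2.sub (i1.mono_set hsub1))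
    intro r hr
    have hz := hpos r ⟨hr.1, by linarith [hr.2]⟩
    have hx : h < t - r := by linarith [hr.2]
    have h1 := fracPow_sub_le hγ0 hγ1 hh hx
    have h2 : t ^ (-γ - 1) ≤ (t - r) ^ (-γ - 1) :=
      Real.rpow_le_rpow_of_nonpos (by linarith) (by linarith [hr.1]) (by linarith)
    rw [← sub_mul, show t - h - r = t - r - h by ring]
    apply mul_le_mul_of_nonneg_right _ hz.le
    refine le_trans ?_ h1
    gcongr
  -- The drop y(t-h) - y(t) is evaluated twice. By `e3` it is the integral of z over the last
  -- interval, at most L h² (`b1`). By `e1` and `e2` it is the gain from the decreasing kernel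
  -- (`b3`) minus the contribution of the last interval (`b2`).
  have key : h * (γ / Real.Gamma (1 - γ) * t ^ (-γ - 1) * (1 - mlSeries γ 1 (t - h))) ≤
      h * (L * h + L * fracPow (2 - γ) h) := by
    linarith
  exact le_of_mul_le_mul_left key hh

/-- Let t₀ be the first point with z ≤ 0. Differentiability gives z ≤ L h on the last interval of
length h, so `mul_one_sub_mlSeries_le` applies. Letting h → 0 yields c(1 - y(t₀)) ≤ 0 with c > 0,
whereas 1 - y(t₀) is the integral of z over (0, t₀) and hence positive. -/
lemma mlSeries_self_pos {γ t : ℝ} (hγ0 : 0 < γ) (hγ1 : γ < 1) (ht : 0 < t) :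
    0 < mlSeries γ γ t := by
  have hγ' : 0 < 1 - γ := by linarith
  by_contra! hneg
  have hqc : Continuous fun s : ℝ => mlEntire γ γ (s ^ γ) :=
    (differentiable_mlEntire hγ0 γ).continuous.comp (Real.continuous_rpow_const hγ0.le)
  have hsign : ∀ s, 0 < s → (0 < mlSeries γ γ s ↔ 0 < mlEntire γ γ (s ^ γ)) := fun s hs => by
    rw [mlSeries_eq hs, mul_pos_iff_of_pos_left (Real.rpow_pos_of_pos hs _)]
  -- The sign is read off the entire factor, which is continuous up to 0 and equals 1/Γ(γ) > 0
  -- there; z itself is singular at 0.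
  set S := Icc 0 t ∩ {s | mlEntire γ γ (s ^ γ) ≤ 0}
  have hScl : IsCompact S :=
    isCompact_Icc.inter_right (isClosed_le hqc continuous_const)
  have hne : S.Nonempty := ⟨t, ⟨ht.le, le_rfl⟩, by
    have := (hsign t ht).not
    simp only [not_lt] at this
    exact this.1 hneg⟩
  obtain ⟨t₀, ht₀S, ht₀min⟩ := hScl.exists_isLeast hne
  have ht₀ : 0 < t₀ := by
    refine ht₀S.1.1.lt_of_ne fun h => ?_
    have h2 := ht₀S.2
    rw [mem_ofPred_eq, ← h, Real.zero_rpow hγ0.ne', mlEntire_zero] at h2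
    exact absurd h2 (not_le.2 (inv_pos.2 (Real.Gamma_pos_of_pos hγ0)))
  have hz₀ : mlSeries γ γ t₀ ≤ 0 := not_lt.1 fun h => not_lt.2 ht₀S.2 ((hsign _ ht₀).1 h)
  have hpos : ∀ r ∈ Ioo 0 t₀, 0 < mlSeries γ γ r := fun r hr => by
    rw [hsign r hr.1]
    by_contra! h
    exact absurd (ht₀min ⟨⟨hr.1.le, hr.2.le.trans ht₀S.1.2⟩, h⟩) (not_le.2 hr.2)
  obtain ⟨L, hL, hO⟩ := (differentiableAt_mlSeries (b := γ) hγ0 ht₀).isBigO_sub.exists_pos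
  rw [Asymptotics.isBigOWith_iff, Metric.eventually_nhds_iff] at hO
  obtain ⟨ε, hε, hO⟩ := hO
  have hev : ∀ᶠ h in 𝓝[>] (0 : ℝ),
      γ / Real.Gamma (1 - γ) * t₀ ^ (-γ - 1) * (1 - mlSeries γ 1 (t₀ - h)) ≤
      L * h + L * fracPow (2 - γ) h := by
    filter_upwards [Ioo_mem_nhdsGT (lt_min hε ht₀)] with h hh
    have h1 := hh.2.trans_le (min_le_left _ _)
    have h2 := hh.2.trans_le (min_le_right _ _)
    refine mul_one_sub_mlSeries_le hγ0 hγ1 hh.1 h2 hpos fun r hr => ?_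
    have habs : |r - t₀| ≤ h := by rw [abs_le]; constructor <;> linarith [hr.1, hr.2, hh.1]
    have h3 := hO (y := r) (by rw [Real.dist_eq]; exact habs.trans_lt h1)
    rw [Real.norm_eq_abs, Real.norm_eq_abs] at h3
    have h4 := le_abs_self (mlSeries γ γ r - mlSeries γ γ t₀)
    have : L * |r - t₀| ≤ L * h := by gcongr
    linarith
  have hlim1 : Tendsto (fun h => γ / Real.Gamma (1 - γ) * t₀ ^ (-γ - 1) *
      (1 - mlSeries γ 1 (t₀ - h))) (𝓝[>] 0)
      (𝓝 (γ / Real.Gamma (1 - γ) * t₀ ^ (-γ - 1) * (1 - mlSeries γ 1 t₀))) := by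
    have hc := (differentiableAt_mlSeries (b := 1) hγ0 ht₀).continuousAt
    have : Tendsto (fun h : ℝ => t₀ - h) (𝓝[>] 0) (𝓝 t₀) := by
      have : Tendsto (fun h : ℝ => t₀ - h) (𝓝 0) (𝓝 (t₀ - 0)) :=
        (continuous_const.sub continuous_id).tendsto 0
      rw [sub_zero] at this
      exact this.mono_left nhdsWithin_le_nhds
    exact ((hc.tendsto.comp this).const_sub 1).const_mul _
  have hlim2 : Tendsto (fun h => L * h + L * fracPow (2 - γ) h) (𝓝[>] 0) (𝓝 0) := by
    have hc : Continuous fun h => L * h + L * fracPow (2 - γ) h := by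
      have := continuous_fracPow (b := 2 - γ) (by linarith)
      fun_prop
    have h0 := hc.tendsto 0
    have : fracPow (2 - γ) 0 = 0 := by
      rw [fracPow, Real.zero_rpow (by intro h; linarith), zero_div]
    rw [this] at h0
    simpa using h0.mono_left nhdsWithin_le_nhds
  have hle := le_of_tendsto_of_tendsto hlim1 hlim2 hev
  have hint : 0 < ∫ s in (0 : ℝ)..t₀, mlSeries γ γ s :=
    intervalIntegral.intervalIntegral_pos_of_pos_on (intervalIntegrable_mlSeries hγ0 hγ0 ht₀)
      hpos ht₀
  rw [integral_mlSeries_self hγ0 ht₀] at hint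
  have hG := Real.Gamma_pos_of_pos hγ'
  have : 0 < γ / Real.Gamma (1 - γ) * t₀ ^ (-γ - 1) * (1 - mlSeries γ 1 t₀) := by positivity
  linarith

lemma mlSeries_one_eq {γ t : ℝ} (ht : 0 < t) : mlSeries γ 1 t = mittagLeffler γ (-t ^ γ) := by
  rw [mlSeries_eq ht, mlEntire_one]
  simp

lemma mittagLeffler_zero (γ : ℝ) : mittagLeffler γ 0 = 1 := by
  have := mlEntire_zero γ 1
  rw [mlEntire_one] at this
  simpa using this

lemma continuous_mittagLeffler {γ : ℝ} (hγ : 0 < γ) : Continuous (mittagLeffler γ) := by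
  have := (differentiable_mlEntire hγ 1).continuous.comp continuous_neg
  refine this.congr fun x => ?_
  simp [mlEntire_one]

lemma mlSeries_one_le_one {γ t : ℝ} (hγ0 : 0 < γ) (hγ1 : γ < 1) (ht : 0 < t) :
    mlSeries γ 1 t ≤ 1 := by
  have := intervalIntegral.integral_nonneg_of_ae_restrict ht.le (μ := volume)
    (f := mlSeries γ γ) (by
      filter_upwards [ae_restrict_mem measurableSet_Icc, Measure.ae_ne _ 0] with r hr hr0
      exact (mlSeries_self_pos hγ0 hγ1 (hr.1.lt_of_ne' hr0)).le)
  rw [integral_mlSeries_self hγ0 ht] at this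
  linarith

lemma mlSeries_one_antitone {γ s t : ℝ} (hγ0 : 0 < γ) (hγ1 : γ < 1) (hs : 0 < s) (hst : s ≤ t) :
    mlSeries γ 1 t ≤ mlSeries γ 1 s := by
  have ht := hs.trans_le hst
  have h1 := integral_mlSeries_self hγ0 hs
  have h2 := integral_mlSeries_self hγ0 ht
  have i := intervalIntegrable_mlSeries hγ0 hγ0 ht
  have : ∫ r in (0 : ℝ)..s, mlSeries γ γ r ≤ ∫ r in (0 : ℝ)..t, mlSeries γ γ r := by
    apply intervalIntegral.integral_mono_interval le_rfl hs.le hst _ i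
    filter_upwards [ae_restrict_mem measurableSet_Ioc] with r hr
    exact (mlSeries_self_pos hγ0 hγ1 hr.1).le
  linarith

/-- y is the convolution of the decreasing kernel `fracPow (1 - γ)` with z ≥ 0. Replacing the kernel
by its least value, at t, gives y ≥ `fracPow (1 - γ) t` · (1 - y). -/
lemma one_le_mlSeries_mul {γ t : ℝ} (hγ0 : 0 < γ) (hγ1 : γ < 1) (ht : 0 < t) :
    1 ≤ mlSeries γ 1 t * (1 + Real.Gamma (1 - γ) * t ^ γ) := by
  have hγ' : 0 < 1 - γ := by linarith
  have h1 := integral_fracPow_mul_mlSeries hγ0 hγ' hγ0 ht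
  rw [sub_add_cancel] at h1
  have h2 : fracPow (1 - γ) t * (1 - mlSeries γ 1 t) ≤ mlSeries γ 1 t := by
    rw [← integral_mlSeries_self hγ0 ht, ← h1, ← intervalIntegral.integral_const_mul]
    apply intervalIntegral.integral_mono_on_of_le_Ioo ht.le
      ((intervalIntegrable_mlSeries hγ0 hγ0 ht).const_mul _)
      (intervalIntegrable_fracPow_mul_mlSeries hγ0 hγ' hγ0 ht)
    intro r hr
    exact mul_le_mul_of_nonneg_right
      (fracPow_antitone hγ0 hγ1 (by linarith [hr.2]) (by linarith [hr.1]))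
      (mlSeries_self_pos hγ0 hγ1 hr.1).le
  have hG := Real.Gamma_pos_of_pos hγ'
  have htγ := Real.rpow_pos_of_pos ht γ
  have h3 : Real.Gamma (1 - γ) * t ^ γ * fracPow (1 - γ) t = 1 := by
    rw [fracPow, sub_sub_cancel_left, Real.rpow_neg ht.le]
    field_simp
  have h4 := mul_le_mul_of_nonneg_left h2 (mul_pos hG htγ).le
  rw [← mul_assoc, h3] at h4
  linarith

/-- 1 - y is the fractional integral of order γ of y, and y is decreasing, so 1 - y(t) ≥ y(t) t^γ /
Γ(γ+1). -/
lemma mlSeries_mul_le_one {γ t : ℝ} (hγ0 : 0 < γ) (hγ1 : γ < 1) (ht : 0 < t) :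
    mlSeries γ 1 t * (1 + (Real.Gamma (γ + 1))⁻¹ * t ^ γ) ≤ 1 := by
  have h1 := integral_fracPow_mul_mlSeries hγ0 hγ0 one_pos ht
  rw [mlSeries_add_eq hγ0 one_pos ht, fracPow_one] at h1
  have h2 := intervalIntegral.integral_mono_on_of_le_Ioo ht.le
      ((intervalIntegrable_fracPow_sub hγ0 ht).mul_const (mlSeries γ 1 t))
      (intervalIntegrable_fracPow_mul_mlSeries hγ0 hγ0 one_pos ht) fun r hr =>
        mul_le_mul_of_nonneg_left (mlSeries_one_antitone hγ0 hγ1 hr.1 hr.2.le)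
          (fracPow_nonneg hγ0 (by linarith [hr.2]))
  rw [h1, intervalIntegral.integral_mul_const, integral_fracPow_sub hγ0 ht, fracPow,
    add_sub_cancel_right, div_eq_inv_mul] at h2
  linarith

/-- Two-sided bounds for the Mittag-Leffler function on the negative half-line. -/
theorem mittagLeffler_neg_bounds {γ x : ℝ} (hγ0 : 0 < γ) (hγ1 : γ < 1) (hx : 0 ≤ x) :
    0 < mittagLeffler γ (-x) ∧ mittagLeffler γ (-x) ≤ 1 ∧
      1 ≤ mittagLeffler γ (-x) * (1 + Real.Gamma (1 - γ) * x) ∧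
      mittagLeffler γ (-x) * (1 + (Real.Gamma (γ + 1))⁻¹ * x) ≤ 1 := by
  rcases hx.eq_or_lt with rfl | hx
  · simp [mittagLeffler_zero]
  have ht : 0 < x ^ γ⁻¹ := Real.rpow_pos_of_pos hx _
  have e : (x ^ γ⁻¹) ^ γ = x := by
    rw [← Real.rpow_mul hx.le, inv_mul_cancel₀ hγ0.ne', Real.rpow_one]
  have h1 := mlSeries_one_le_one hγ0 hγ1 ht
  have h2 := one_le_mlSeries_mul hγ0 hγ1 ht
  have h3 := mlSeries_mul_le_one hγ0 hγ1 ht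
  rw [mlSeries_one_eq ht, e] at h1 h2 h3
  refine ⟨?_, h1, h2, h3⟩
  have hG := Real.Gamma_pos_of_pos (sub_pos.2 hγ1)
  by_contra! h
  have : 0 < 1 + Real.Gamma (1 - γ) * x := by positivity
  nlinarith

end FracDiffusion

namespace FracDiffusion

/-! ### The abstract fractional Cauchy problem -/

section Abstract

variable {X : Type*} [NormedAddCommGroup X] [NormedSpace ℝ X]

lemma integral_Ioc_fracPow_mul_fracPow {a b r t : ℝ} (ha : 0 < a) (hb : 0 < b) (hrt : r < t) :
    IntegrableOn (fun s => fracPow a (t - s) * fracPow b (s - r)) (Ioc r t) ∧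
    ∫ s in Ioc r t, fracPow a (t - s) * fracPow b (s - r) = fracPow (a + b) (t - r) := by
  have hrt' : 0 < t - r := sub_pos.2 hrt
  have h1 := intervalIntegrable_fracPow_mul_fracPow ha hb hrt'
  have h2 := integral_fracPow_mul_fracPow ha hb hrt'
  have e : ∀ s, fracPow a (t - r - (s - r)) = fracPow a (t - s) := fun s => by congr 1; ring
  constructor
  · have := h1.comp_sub_right r
    simp only [zero_add, sub_add_cancel, e] at this
    exact (intervalIntegrable_iff_integrableOn_Ioc_of_le hrt.le).1 this
  · rw [← intervalIntegral.integral_of_le hrt.le, ← h2]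
    have := intervalIntegral.integral_comp_sub_right
      (fun x => fracPow a (t - r - x) * fracPow b x) (a := r) (b := t) r
    simp only [sub_self, e] at this
    exact this

lemma fracPow_one_sub_eq {γ x : ℝ} (hx : 0 ≤ x) :
    fracPow (1 - γ) x = (Real.Gamma (1 - γ))⁻¹ * (x ^ γ)⁻¹ := by
  rw [fracPow, sub_sub_cancel_left, Real.rpow_neg hx, div_eq_inv_mul]

lemma caputoDeriv_eq {γ t : ℝ} (ht : 0 ≤ t) (w : ℝ → X) :
    caputoDeriv γ w t = ∫ r in Ioc 0 t, fracPow (1 - γ) (t - r) • deriv w r := by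
  rw [caputoDeriv, intervalIntegral.integral_of_le ht, ← integral_smul]
  apply setIntegral_congr_fun measurableSet_Ioc
  intro r hr
  dsimp only
  rw [fracPow_one_sub_eq (sub_nonneg.2 hr.2), smul_smul]

/-- The Riemann-Liouville integral of order `γ` inverts the integral of order `1 - γ`, up to
an integration. -/
lemma integral_fracPow_smul_integral [CompleteSpace X] {γ t : ℝ} (hγ0 : 0 < γ) (hγ1 : γ < 1) {f : ℝ → X}
    (hf : IntegrableOn f (Ioc 0 t)) :
    ∫ s in Ioc 0 t, fracPow γ (t - s) • ∫ r in Ioc 0 s, fracPow (1 - γ) (s - r) • f r =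
      ∫ r in Ioc 0 t, f r := by
  have hγ' : 0 < 1 - γ := by linarith
  set μ : Measure ℝ := volume.restrict (Ioc 0 t)
  -- Fubini on the triangle r < s ≤ t: by the semigroup law with γ + (1-γ) = 1, the integral of K in
  -- s is identically 1.
  set K : ℝ → ℝ → ℝ := fun s r =>
    (Iio s).indicator (fun r => fracPow γ (t - s) * fracPow (1 - γ) (s - r)) r
  have hKm : Measurable (Function.uncurry K) := by
    have : Function.uncurry K = {q : ℝ × ℝ | q.2 < q.1}.indicator
        (fun q => fracPow γ (t - q.1) * fracPow (1 - γ) (q.1 - q.2)) := by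
      ext ⟨s, r⟩
      simp [K, indicator]
    rw [this]
    exact (Measurable.mul ((measurable_fracPow _).comp (by fun_prop))
      ((measurable_fracPow _).comp (by fun_prop))).indicator
        (measurableSet_lt measurable_snd measurable_fst)
  have hKr : ∀ r, (fun s => K s r) =
      (Ioi r).indicator (fun s => fracPow γ (t - s) * fracPow (1 - γ) (s - r)) := fun r => by
    ext s
    simp [K, indicator]
  have hset : ∀ r ∈ Ioo 0 t, μ.restrict (Ioi r) = volume.restrict (Ioc r t) := fun r hr => by
    rw [Measure.restrict_restrict measurableSet_Ioi]
    congr 1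
    ext s
    simp only [mem_inter_iff, mem_Ioi, mem_Ioc]
    exact ⟨fun h => ⟨h.1, h.2.2⟩, fun h => ⟨h.1, hr.1.trans h.1, h.2⟩⟩
  have hKi : ∀ r ∈ Ioo 0 t, Integrable (fun s => K s r) μ := fun r hr => by
    rw [hKr, integrable_indicator_iff measurableSet_Ioi, IntegrableOn, hset r hr]
    exact (integral_Ioc_fracPow_mul_fracPow hγ0 hγ' hr.2).1
  have hKint : ∀ r ∈ Ioo 0 t, ∫ s, K s r ∂μ = 1 := fun r hr => by
    rw [hKr, integral_indicator measurableSet_Ioi, hset r hr,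
      (integral_Ioc_fracPow_mul_fracPow hγ0 hγ' hr.2).2, add_sub_cancel, fracPow_one]
  have hKn : ∀ r, ∀ᵐ s ∂μ, ‖K s r‖ = K s r := fun r => by
    filter_upwards [ae_restrict_mem measurableSet_Ioc] with s hs
    rw [Real.norm_eq_abs, abs_of_nonneg]
    apply indicator_nonneg
    intro r hr
    exact mul_nonneg (fracPow_nonneg hγ0 (sub_nonneg.2 hs.2))
      (fracPow_nonneg hγ' (sub_nonneg.2 (le_of_lt hr)))
  have hae : ∀ᵐ r ∂μ, r ∈ Ioo 0 t := by
    filter_upwards [ae_restrict_mem measurableSet_Ioc, Measure.ae_ne _ t] with r hr hr'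
    exact ⟨hr.1, hr.2.lt_of_ne hr'⟩
  have hint : Integrable (Function.uncurry fun s r => K s r • f r) (μ.prod μ) := by
    have hm : AEStronglyMeasurable (Function.uncurry fun s r => K s r • f r) (μ.prod μ) :=
      hKm.aestronglyMeasurable.smul hf.aestronglyMeasurable.comp_snd
    rw [integrable_prod_iff' hm]
    constructor
    · filter_upwards [hae] with r hr
      exact (hKi r hr).smul_const (f r)
    · refine hf.norm.congr ?_
      filter_upwards [hae] with r hr
      simp only [Function.uncurry_apply_pair, norm_smul]
      rw [integral_mul_const, integral_congr_ae (hKn r), hKint r hr, one_mul]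
  calc _ = ∫ s, ∫ r, K s r • f r ∂μ ∂μ := by
        apply setIntegral_congr_fun measurableSet_Ioc
        intro s hs
        dsimp only
        rw [← integral_smul]
        have : ∀ r, K s r • f r = (Iio s).indicator
            (fun r => fracPow γ (t - s) • fracPow (1 - γ) (s - r) • f r) r := fun r => by
          by_cases h : r < s <;> simp [K, h, smul_smul]
        simp_rw [this]
        rw [integral_indicator measurableSet_Iio, Measure.restrict_restrict measurableSet_Iio,
          integral_Ioc_eq_integral_Ioo]
        congr 2
        ext r
        simp only [mem_inter_iff, mem_Iio, mem_Ioc, mem_Ioo]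
        exact ⟨fun h => ⟨h.2, h.1, h.2.le.trans hs.2⟩, fun h => ⟨h.2.1, h.1⟩⟩
    _ = ∫ r, ∫ s, K s r • f r ∂μ ∂μ := integral_integral_swap hint
    _ = ∫ r, f r ∂μ := by
        apply integral_congr_ae
        filter_upwards [hae] with r hr
        rw [integral_smul_const, hKint r hr, one_smul]

/-- `w` solves the fractional evolution equation `∂^γ w / ∂t^γ = -A w` on `(0,T)`. -/
structure IsCaputoSolution (γ T : ℝ) (A : X →L[ℝ] X) (w : ℝ → X) : Prop where
  continuousOn : ContinuousOn w (Icc 0 T)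
  differentiableAt : ∀ t ∈ Ioo 0 T, DifferentiableAt ℝ w t
  integrable : ∀ t ∈ Ioo 0 T,
    IntervalIntegrable (fun r => ((t - r) ^ γ)⁻¹ • deriv w r) volume 0 t
  equation : ∀ t ∈ Ioo 0 T, caputoDeriv γ w t = -A (w t)

namespace IsCaputoSolution

variable {γ T : ℝ} {A : X →L[ℝ] X} {w : ℝ → X}

/-- Multiplying the Caputo integrand by the continuous function (t-r)^γ removes the weight. This
makes the fundamental theorem of calculus available on [0, t]. -/
lemma intervalIntegrable_deriv (h : IsCaputoSolution γ T A w) (hγ : 0 < γ) {t : ℝ}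
    (ht : t ∈ Ioo 0 T) : IntervalIntegrable (deriv w) volume 0 t := by
  have hc : ContinuousOn (fun r : ℝ => (t - r) ^ γ) (uIcc 0 t) :=
    ((Real.continuous_rpow_const hγ.le).comp (continuous_const.sub continuous_id)).continuousOn
  refine ((h.integrable t ht).continuousOn_smul hc).congr_ae ?_
  filter_upwards [ae_restrict_mem measurableSet_uIoc, Measure.ae_ne _ t] with r hr hrt
  rw [uIoc_of_le ht.1.le] at hr
  have : 0 < (t - r) ^ γ := Real.rpow_pos_of_pos (sub_pos.2 (hr.2.lt_of_ne hrt)) _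
  rw [smul_smul, mul_inv_cancel₀ this.ne', one_smul]

variable [CompleteSpace X]

/-- The equivalent Volterra integral equation. -/
lemma volterra (h : IsCaputoSolution γ T A w) (hγ0 : 0 < γ) (hγ1 : γ < 1) {t : ℝ}
    (ht : t ∈ Ioo 0 T) :
    w t = w 0 - ∫ s in (0 : ℝ)..t, fracPow γ (t - s) • A (w s) := by
  have hd := h.intervalIntegrable_deriv hγ0 ht
  have hftc : ∫ r in (0 : ℝ)..t, deriv w r = w t - w 0 :=
    intervalIntegral.integral_eq_sub_of_hasDerivAt_of_le ht.1.le
      (h.continuousOn.mono (Icc_subset_Icc_right ht.2.le))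
      (fun r hr => (h.differentiableAt r ⟨hr.1, hr.2.trans ht.2⟩).hasDerivAt) hd
  rw [intervalIntegrable_iff_integrableOn_Ioc_of_le ht.1.le] at hd
  -- The integral of w' is the integral of order γ of the integral of order 1-γ of w'; the inner one
  -- is the Caputo derivative, known from the equation.
  rw [intervalIntegral.integral_of_le ht.1.le, ← integral_fracPow_smul_integral hγ0 hγ1 hd] at hftc
  rw [sub_eq_add_neg, ← sub_eq_iff_eq_add', ← hftc, intervalIntegral.integral_of_le ht.1.le, ← integral_neg]
  apply setIntegral_congr_fun measurableSet_Ioc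
  intro s hs
  dsimp only
  rw [← caputoDeriv_eq hs.1.le, h.equation s ⟨hs.1, hs.2.trans_lt ht.2⟩, smul_neg]

/-- The partial sums of the Mittag-Leffler expansion. -/
noncomputable def partialSum (γ : ℝ) (A : X →L[ℝ] X) (x : X) (N : ℕ) (t : ℝ) : X :=
  ∑ k ∈ Finset.range N, fracPow (γ * k + 1) t • ((-A) ^ k) x

omit [CompleteSpace X] in
lemma continuous_partialSum (hγ0 : 0 < γ) (x : X) (N : ℕ) :
    Continuous (partialSum γ A x N) := by
  unfold partialSum
  refine continuous_finsetSum _ fun k _ => ?_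
  exact (continuous_fracPow (by have : 0 ≤ γ * k := by positivity
                                linarith)).smul continuous_const

/-- The partial sums are the Picard iterates of the Volterra equation, started from 0. -/
lemma partialSum_succ (hγ0 : 0 < γ) (x : X) (N : ℕ) {t : ℝ} (ht : 0 < t) :
    partialSum γ A x (N + 1) t =
      x - ∫ s in (0 : ℝ)..t, fracPow γ (t - s) • A (partialSum γ A x N s) := by
  have hpos : ∀ k : ℕ, 0 < γ * k + 1 := fun k => by positivity
  have e : ∀ s, fracPow γ (t - s) • A (partialSum γ A x N s) =
      ∑ k ∈ Finset.range N, (fracPow γ (t - s) * fracPow (γ * k + 1) s) • A (((-A) ^ k) x) := by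
    intro s
    simp [partialSum, map_sum, Finset.smul_sum, smul_smul]
  simp_rw [e]
  rw [intervalIntegral.integral_finsetSum fun k _ =>
    (intervalIntegrable_fracPow_mul_fracPow hγ0 (hpos k) ht).smul_continuousOn
      continuousOn_const]
  simp_rw [intervalIntegral.integral_smul_const, integral_fracPow_mul_fracPow hγ0 (hpos _) ht]
  rw [partialSum, Finset.sum_range_succ', sub_eq_add_neg, ← Finset.sum_neg_distrib, add_comm]
  congr 1
  · simp
  · refine Finset.sum_congr rfl fun k _ => ?_
    rw [pow_succ', ← smul_neg]
    push_cast
    rw [show γ * (k + 1) + 1 = γ + (γ * k + 1) by ring]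
    rfl

/-- Each Picard step costs a factor ‖A‖ and a fractional integration of order γ, which the semigroup
law evaluates exactly on power kernels. -/
lemma norm_sub_partialSum_le (h : IsCaputoSolution γ T A w) (hγ0 : 0 < γ) (hγ1 : γ < 1)
    {M : ℝ} (hM : ∀ t ∈ Icc 0 T, ‖w t‖ ≤ M) (N : ℕ) :
    ∀ t ∈ Ioo 0 T, ‖w t - partialSum γ A (w 0) N t‖ ≤ ‖A‖ ^ N * M * fracPow (γ * N + 1) t := by
  induction N with
  | zero =>
    intro t ht
    simpa [partialSum] using hM t ⟨ht.1.le, ht.2.le⟩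
  | succ N ih =>
    intro t ht
    have hpos : 0 < γ * N + 1 := by positivity
    have hw : ContinuousOn (fun s => A (w s)) (uIcc 0 t) := by
      rw [uIcc_of_le ht.1.le]
      exact A.continuous.comp_continuousOn (h.continuousOn.mono (Icc_subset_Icc_right ht.2.le))
    have hp : ContinuousOn (fun s => A (partialSum γ A (w 0) N s)) (uIcc 0 t) :=
      (A.continuous.comp (continuous_partialSum hγ0 _ _)).continuousOn
    have hk := intervalIntegrable_fracPow_sub hγ0 ht.1
    have hI := (intervalIntegrable_fracPow_mul_fracPow hγ0 hpos ht.1)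
    rw [h.volterra hγ0 hγ1 ht, partialSum_succ hγ0 _ _ ht.1, sub_sub_sub_cancel_left,
      ← intervalIntegral.integral_sub (hk.smul_continuousOn hp) (hk.smul_continuousOn hw),
      show γ * ((N + 1 : ℕ) : ℝ) + 1 = γ + (γ * N + 1) by push_cast; ring,
      ← integral_fracPow_mul_fracPow hγ0 hpos ht.1, ← intervalIntegral.integral_const_mul]
    apply intervalIntegral.norm_integral_le_of_norm_le ht.1.le _ (hI.const_mul _)
    filter_upwards [Measure.ae_ne _ t] with s hst hs
    have hs' : s ∈ Ioo 0 T := ⟨hs.1, hs.2.trans_lt ht.2⟩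
    have hk0 := fracPow_nonneg hγ0 (sub_nonneg.2 hs.2)
    rw [← smul_sub, ← map_sub, norm_smul, Real.norm_eq_abs, abs_of_nonneg hk0]
    calc fracPow γ (t - s) * ‖A (partialSum γ A (w 0) N s - w s)‖
        ≤ fracPow γ (t - s) * (‖A‖ * (‖A‖ ^ N * M * fracPow (γ * N + 1) s)) := by
          gcongr
          refine (A.le_opNorm _).trans ?_
          rw [norm_sub_rev]
          gcongr
          exact ih s hs'
      _ = _ := by ring

/-- The solution of the fractional evolution equation is given by the Mittag-Leffler series. -/
theorem tendsto_sum (h : IsCaputoSolution γ T A w) (hγ0 : 0 < γ) (hγ1 : γ < 1) (hT : 0 < T)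
    {t : ℝ} (ht : t ∈ Icc 0 T) :
    Tendsto (fun N : ℕ => ∑ k ∈ Finset.range N,
      ((t ^ γ) ^ k / Real.Gamma (γ * k + 1)) • ((-A) ^ k) (w 0)) atTop (𝓝 (w t)) := by
  obtain ⟨M, hM⟩ := isCompact_Icc.exists_bound_of_continuousOn h.continuousOn
  have hpow : ∀ k : ℕ, fracPow (γ * k + 1) t = (t ^ γ) ^ k / Real.Gamma (γ * k + 1) := fun k => by
    rw [fracPow, add_sub_cancel_right, Real.rpow_mul ht.1, Real.rpow_natCast]
  have hb : ∀ N, ‖w t - partialSum γ A (w 0) N t‖ ≤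
      ‖A‖ ^ N * M * fracPow (γ * N + 1) t := fun N => by
    -- The Volterra equation is available only on the open interval; both endpoints are reached by
    -- continuity.
    have hcl : t ∈ closure (Ioo 0 T) := by rwa [closure_Ioo hT.ne]
    refine ContinuousWithinAt.closure_le (s := Ioo 0 T)
      (f := fun t => ‖w t - partialSum γ A (w 0) N t‖)
      (g := fun t => ‖A‖ ^ N * M * fracPow (γ * N + 1) t) hcl ?_ ?_
      (h.norm_sub_partialSum_le hγ0 hγ1 hM N)
    · exact (((h.continuousOn t ht).mono Ioo_subset_Icc_self).sub
        (continuous_partialSum hγ0 _ _).continuousWithinAt).norm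
    · exact (continuous_const.mul (continuous_fracPow (by
        have : 0 ≤ γ * (N : ℝ) := by positivity
        linarith))).continuousWithinAt
  have h0 : Tendsto (fun N : ℕ => ‖A‖ ^ N * M * fracPow (γ * N + 1) t) atTop (𝓝 0) := by
    have := ((summable_pow_div_Gamma (b := 1) hγ0 (‖A‖ * t ^ γ)).tendsto_atTop_zero).const_mul M
    rw [mul_zero] at this
    refine this.congr fun N => ?_
    rw [hpow, mul_pow]
    ring
  rw [tendsto_iff_norm_sub_tendsto_zero]
  refine squeeze_zero (fun _ => norm_nonneg _) (fun N => ?_) h0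
  rw [norm_sub_rev]
  simpa only [partialSum, hpow] using hb N

end IsCaputoSolution

end Abstract

end FracDiffusion

namespace FracDiffusion

/-! ### The solution in the frequency domain -/

variable {n : ℕ}

lemma angFreq_nonneg (η : Rn n) : 0 ≤ angFreq η := by unfold angFreq; positivity

@[fun_prop]
lemma continuous_angFreq : Continuous (angFreq : Rn n → ℝ) := by unfold angFreq; fun_prop

/-- The Fourier transform turns the Laplacian into multiplication by `-|ξ|²`. -/
lemma fourier_ae_eq_of_eq_laplacian {c v : L2 n}
    (h : (c : 𝓢'(Rn n, ℂ)) = Δ (v : 𝓢'(Rn n, ℂ))) :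
    ∀ᵐ η, (𝓕 c : L2 n) η = -((angFreq η ^ 2 : ℝ) : ℂ) * (𝓕 v : L2 n) η := by
  have hg : (fun x : Rn n ↦ Complex.ofReal (‖x‖ ^ 2)).HasTemperateGrowth := by fun_prop
  have h1 : ((𝓕 c : L2 n) : 𝓢'(Rn n, ℂ)) = (-(2 * Real.pi) ^ 2 : ℝ) •
      TemperedDistribution.smulLeftCLM ℂ (fun x ↦ Complex.ofReal (‖x‖ ^ 2))
        ((𝓕 v : L2 n) : 𝓢'(Rn n, ℂ)) := by
    rw [← Lp.fourier_toTemperedDistribution_eq, h,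
      TemperedDistribution.laplacian_eq_fourierMultiplierCLM,
      TemperedDistribution.fourierMultiplierCLM_apply, ← Lp.fourier_toTemperedDistribution_eq,
      ← Complex.coe_smul, FourierTransform.fourier_smul, FourierTransform.fourier_fourierInv_eq]
    exact Complex.coe_smul _ _
  have hv : LocallyIntegrable ((𝓕 v : L2 n) : Rn n → ℂ) :=
    (Lp.memLp (𝓕 v : L2 n)).locallyIntegrable (by norm_num)
  refine ae_eq_of_integral_contDiff_smul_eq
    ((Lp.memLp (𝓕 c : L2 n)).locallyIntegrable (by norm_num)) ?_ fun g hg1 hg2 => ?_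
  · have hc : ContinuousOn (fun η : Rn n => -((angFreq η ^ 2 : ℝ) : ℂ)) univ := by
      apply Continuous.continuousOn
      fun_prop
    have := (hv.locallyIntegrableOn univ).continuousOn_mul hc isOpen_univ.isLocallyClosed
    exact locallyIntegrableOn_univ.1 this
  · have hg₁ : HasCompactSupport (Complex.ofRealCLM ∘ g) := hg2.comp_left rfl
    have hg₂ : ContDiff ℝ (⊤ : ℕ∞) (Complex.ofRealCLM ∘ g) := by fun_prop
    have := congrArg (fun F : 𝓢'(Rn n, ℂ) => F (hg₁.toSchwartzMap hg₂)) h1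
    simp only [← Complex.coe_smul, smul_apply,
      TemperedDistribution.smulLeftCLM_apply_apply,
      Lp.toTemperedDistribution_apply, SchwartzMap.smulLeftCLM_apply_apply hg,
      HasCompactSupport.toSchwartzMap_toFun, ← integral_smul] at this
    refine Eq.trans ?_ (this.trans ?_)
    · congr 1
    · congr 1
      ext η
      simp [angFreq]
      ring

/-- Multiplication by a bounded measurable function, as an operator on `L²`. -/
noncomputable def mulOp (a : Lp ℂ ∞ (volume : Measure (Rn n))) : L2 n →L[ℝ] L2 n :=
  ((ContinuousLinearMap.mul ℂ ℂ).holderL volume ∞ 2 2 a).restrictScalars ℝ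

lemma coeFn_mulOp (a : Lp ℂ ∞ (volume : Measure (Rn n))) (f : L2 n) :
    ∀ᵐ η, mulOp a f η = a η * f η :=
  (ContinuousLinearMap.mul ℂ ℂ).coeFn_holder (r := 2) a f

lemma coeFn_neg_mulOp_pow (a : Lp ℂ ∞ (volume : Measure (Rn n))) (f : L2 n) (k : ℕ) :
    ∀ᵐ η, ((-mulOp a) ^ k) f η = (-a η) ^ k * f η := by
  induction k with
  | zero => simp
  | succ k ih =>
    rw [pow_succ']
    filter_upwards [ih, coeFn_mulOp a (((-mulOp a) ^ k) f),
      Lp.coeFn_neg (mulOp a (((-mulOp a) ^ k) f))] with η h1 h2 h3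
    change (-(mulOp a (((-mulOp a) ^ k) f)) : L2 n) η = _
    rw [h3, Pi.neg_apply, h2, h1]
    ring

/-- The truncated symbol `|ξ|^j 1_{|ξ| ≤ R}`. -/
noncomputable def cutSymbol (R : ℝ) (j : ℕ) (η : Rn n) : ℂ :=
  {η : Rn n | angFreq η ≤ R}.indicator (fun η => ((angFreq η ^ j : ℝ) : ℂ)) η

lemma memLp_cutSymbol (R : ℝ) (j : ℕ) :
    MemLp (cutSymbol R j : Rn n → ℂ) ∞ volume := by
  apply memLp_top_of_bound (C := |R| ^ j)
  · apply Measurable.aestronglyMeasurable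
    exact Measurable.indicator (by fun_prop) (measurableSet_le (by fun_prop) (by fun_prop))
  · refine Eventually.of_forall fun η => ?_
    unfold cutSymbol
    by_cases h : angFreq η ≤ R
    · have h0 := angFreq_nonneg η
      rw [indicator_of_mem (by exact h), Complex.norm_real, norm_pow, Real.norm_eq_abs]
      gcongr
    · rw [indicator_of_notMem (by exact h), norm_zero]
      positivity

/-- The Fourier transform followed by the cut-off at frequency `R`. -/
noncomputable def cutFourier (R : ℝ) : L2 n →L[ℝ] L2 n :=
  mulOp ((memLp_cutSymbol R 0).toLp _) ∘L (FourierTransform.fourierCLM ℂ (L2 n)).restrictScalars ℝ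

lemma coeFn_cutFourier (R : ℝ) (f : L2 n) :
    ∀ᵐ η, cutFourier R f η = cutSymbol R 0 η * (𝓕 f : L2 n) η := by
  filter_upwards [coeFn_mulOp ((memLp_cutSymbol R 0).toLp _) (𝓕 f : L2 n),
    (memLp_cutSymbol (n := n) R 0).coeFn_toLp] with η h1 h2
  rw [← h2]
  exact h1

/-- Below frequency R the Laplacian is a bounded multiplier, and the cut-off Fourier transform,
being bounded and linear, commutes with the time derivative and the Caputo integral. -/
lemma isCaputoSolution_cutFourier {γ T : ℝ} {g : L2 n} {u : ℝ → L2 n}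
    (hu : IsWeakSolution γ T g u) (R : ℝ) :
    IsCaputoSolution γ T (mulOp ((memLp_cutSymbol (n := n) R 2).toLp _))
      fun t => cutFourier R (u t) := by
  have hder : ∀ t ∈ Ioo 0 T, HasDerivAt (fun t => cutFourier R (u t))
      (cutFourier R (deriv u t)) t := fun t ht =>
    (cutFourier R).hasFDerivAt.comp_hasDerivAt t (hu.differentiableAt t ht).hasDerivAt
  have hfun : ∀ t ∈ Ioo 0 T, EqOn
      (fun r => ((t - r) ^ γ)⁻¹ • deriv (fun t => cutFourier R (u t)) r)
      (fun r => cutFourier R (((t - r) ^ γ)⁻¹ • deriv u r)) (Ioc 0 t) := fun t ht r hr => by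
    dsimp only
    rw [(hder r ⟨hr.1, hr.2.trans_lt ht.2⟩).deriv, map_smul]
  refine ⟨(cutFourier R).continuous.comp_continuousOn hu.continuousOn_L2,
    fun t ht => (hder t ht).differentiableAt, fun t ht => ?_, fun t ht => ?_⟩
  · have := hu.integrable t ht
    rw [intervalIntegrable_iff_integrableOn_Ioc_of_le ht.1.le] at this ⊢
    exact IntegrableOn.congr_fun ((cutFourier R).integrable_comp this) (hfun t ht).symm
      measurableSet_Ioc
  · have h1 : caputoDeriv γ (fun t => cutFourier R (u t)) t =
        cutFourier R (caputoDeriv γ u t) := by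
      rw [caputoDeriv, caputoDeriv, map_smul,
        ← (cutFourier R).intervalIntegral_comp_comm (hu.integrable t ht)]
      congr 1
      rw [intervalIntegral.integral_of_le ht.1.le, intervalIntegral.integral_of_le ht.1.le]
      exact setIntegral_congr_fun measurableSet_Ioc (hfun t ht)
    rw [h1]
    apply Lp.ext
    filter_upwards [coeFn_cutFourier R (caputoDeriv γ u t), coeFn_cutFourier R (u t),
      coeFn_mulOp ((memLp_cutSymbol (n := n) R 2).toLp _) (cutFourier R (u t)),
      (memLp_cutSymbol (n := n) R 2).coeFn_toLp, fourier_ae_eq_of_eq_laplacian (hu.equation t ht),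
      Lp.coeFn_neg (mulOp ((memLp_cutSymbol (n := n) R 2).toLp _) (cutFourier R (u t)))]
      with η e1 e2 e3 e4 e5 e6
    rw [e6, Pi.neg_apply, e1, e3, e2, e4, e5]
    by_cases h : angFreq η ≤ R
    · simp [cutSymbol, h]
    · simp [cutSymbol, h]

/-- The frequency representation of weak solutions. -/
theorem fourier_weakSolution {γ T : ℝ} {g : L2 n} {u : ℝ → L2 n} (hγ0 : 0 < γ) (hγ1 : γ < 1)
    (hT : 0 < T) (hu : IsWeakSolution γ T g u) {t : ℝ} (ht : t ∈ Icc 0 T) :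
    ∀ᵐ η, (𝓕 (u t) : L2 n) η =
      ((mittagLeffler γ (-(angFreq η ^ 2) * t ^ γ) : ℝ) : ℂ) * (𝓕 (u 0) : L2 n) η := by
  -- Integer cut-offs keep the exceptional null sets countable in number.
  have main : ∀ R : ℕ, ∀ᵐ η : Rn n, angFreq η ≤ R → (𝓕 (u t) : L2 n) η =
      ((mittagLeffler γ (-(angFreq η ^ 2) * t ^ γ) : ℝ) : ℂ) * (𝓕 (u 0) : L2 n) η := by
    intro R
    set A := mulOp ((memLp_cutSymbol (n := n) R 2).toLp _)
    have hlim := (isCaputoSolution_cutFourier hu R).tendsto_sum hγ0 hγ1 hT ht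
    -- L² convergence gives a.e. convergence along a subsequence. That suffices, since the scalar
    -- series converges pointwise and identifies the limit.
    obtain ⟨ns, hns, hae⟩ := (tendstoInMeasure_of_tendsto_Lp hlim).exists_seq_tendsto_ae
    have hsum : ∀ N : ℕ, ∀ᵐ η : Rn n, (∑ k ∈ Finset.range N,
        ((t ^ γ) ^ k / Real.Gamma (γ * k + 1)) • ((-A) ^ k) (cutFourier R (u 0)) : L2 n) η =
        ∑ k ∈ Finset.range N, (((t ^ γ) ^ k / Real.Gamma (γ * k + 1) : ℝ) : ℂ) *
          ((-(cutSymbol R 2 η)) ^ k * cutFourier R (u 0) η) := by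
      intro N
      induction N with
      | zero =>
        simp only [Finset.range_zero, Finset.sum_empty]
        exact Lp.coeFn_zero _ _ _
      | succ N ih =>
        simp only [Finset.sum_range_succ]
        filter_upwards [ih, coeFn_neg_mulOp_pow ((memLp_cutSymbol (n := n) R 2).toLp _)
          (cutFourier R (u 0)) N, (memLp_cutSymbol (n := n) R 2).coeFn_toLp,
          Lp.coeFn_add (∑ k ∈ Finset.range N, ((t ^ γ) ^ k / Real.Gamma (γ * k + 1)) •
            ((-A) ^ k) (cutFourier R (u 0))) (((t ^ γ) ^ N / Real.Gamma (γ * N + 1)) •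
            ((-A) ^ N) (cutFourier R (u 0))),
          Lp.coeFn_smul ((t ^ γ) ^ N / Real.Gamma (γ * N + 1))
            (((-A) ^ N) (cutFourier R (u 0)))] with η e1 e2 e3 e4 e5
        rw [e4, Pi.add_apply, e1, e5, Pi.smul_apply, e2, e3, Complex.real_smul]
    filter_upwards [hae, ae_all_iff.2 hsum, coeFn_cutFourier (R : ℝ) (u t),
      coeFn_cutFourier (R : ℝ) (u 0)] with η h1 h2 h3 h4 hR
    have c0 : cutSymbol (R : ℝ) 0 η = 1 := by simp [cutSymbol, hR]
    have c2 : cutSymbol (R : ℝ) 2 η = ((angFreq η ^ 2 : ℝ) : ℂ) := by simp [cutSymbol, hR]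
    replace h1 := h1.congr fun i => h2 (ns i)
    simp only [h3, h4, c0, c2, one_mul] at h1
    have hs := (summable_pow_div_Gamma (b := 1) hγ0 (-(angFreq η ^ 2) * t ^ γ)).hasSum
    have h5 := ((Complex.hasSum_ofReal.2 hs).mul_right ((𝓕 (u 0) : L2 n) η)).tendsto_sum_nat.comp
      hns.tendsto_atTop
    refine tendsto_nhds_unique h1 (h5.congr fun i => ?_)
    simp only [Function.comp_apply]
    refine Finset.sum_congr rfl fun k _ => ?_
    push_cast
    rw [mul_pow]
    ring
  filter_upwards [ae_all_iff.2 main] with η hη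
  obtain ⟨R, hR⟩ := exists_nat_ge (angFreq η)
  exact hη R hR

end FracDiffusion

namespace FracDiffusion

/-! ### The mollifier in the frequency domain -/

variable {n : ℕ}

lemma integral_fourier_mul_eq {f g : Rn n → ℂ} (hf : Integrable f) (hg : Integrable g) :
    ∫ x, 𝓕 f x * g x = ∫ x, f x * 𝓕 g x := by
  have := VectorFourier.integral_fourierIntegral_smul_eq_flip (L := innerₗ (Rn n))
    Real.continuous_fourierChar continuous_inner hf hg
  rw [flip_innerₗ] at this
  exact this

lemma fourierInv_eq_fourier_comp (f : Rn n → ℂ) (x : Rn n) : 𝓕⁻ f x = 𝓕 f (-x) :=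
  Real.fourierInv_eq_fourier_neg f x

lemma continuous_fourier {f : Rn n → ℂ} (hf : Integrable f) : Continuous (𝓕 f) :=
  VectorFourier.fourierIntegral_continuous Real.continuous_fourierChar
    (by exact continuous_inner) hf

/-- The `L²` Fourier transform of an integrable function is given by the Fourier integral. -/
lemma coeFn_fourier_toLp {f : Rn n → ℂ} (hf : Integrable f) (hf2 : MemLp f 2) :
    ∀ᵐ x, (𝓕 (hf2.toLp f) : L2 n) x = 𝓕 f x := by
  refine ae_eq_of_integral_contDiff_smul_eq
    ((Lp.memLp (𝓕 (hf2.toLp f) : L2 n)).locallyIntegrable (by norm_num))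
    (continuous_fourier hf).locallyIntegrable fun g hg1 hg2 => ?_
  have hg₁ : HasCompactSupport (Complex.ofRealCLM ∘ g) := hg2.comp_left rfl
  have hg₂ : ContDiff ℝ (⊤ : ℕ∞) (Complex.ofRealCLM ∘ g) := by fun_prop
  set φ := hg₁.toSchwartzMap hg₂
  have h := congrArg (fun F : 𝓢'(Rn n, ℂ) => F φ)
    (Lp.fourier_toTemperedDistribution_eq (hf2.toLp f))
  simp only [TemperedDistribution.fourier_apply, Lp.toTemperedDistribution_apply] at h
  have h2 := integral_fourier_mul_eq hf φ.integrable
  calc _ = ∫ x, φ x • (𝓕 (hf2.toLp f) : L2 n) x := rfl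
    _ = ∫ x, f x * 𝓕 (φ : Rn n → ℂ) x := by
        rw [← h]
        apply integral_congr_ae
        filter_upwards [hf2.coeFn_toLp] with x hx
        rw [hx, smul_eq_mul, mul_comm, SchwartzMap.fourier_coe]
    _ = _ := by
        rw [← h2]
        congr 1
        ext x
        rw [mul_comm]
        rfl

lemma coeFn_fourierInv_toLp {f : Rn n → ℂ} (hf : Integrable f) (hf2 : MemLp f 2) :
    ∀ᵐ x, (𝓕⁻ (hf2.toLp f) : L2 n) x = 𝓕⁻ f x := by
  have hcont : Continuous (𝓕⁻ f) := by
    have : 𝓕⁻ f = fun x => 𝓕 f (-x) := funext fun x => fourierInv_eq_fourier_comp f x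
    rw [this]
    exact (continuous_fourier hf).comp continuous_neg
  refine ae_eq_of_integral_contDiff_smul_eq
    ((Lp.memLp (𝓕⁻ (hf2.toLp f) : L2 n)).locallyIntegrable (by norm_num))
    hcont.locallyIntegrable fun g hg1 hg2 => ?_
  have hg₁ : HasCompactSupport (Complex.ofRealCLM ∘ g) := hg2.comp_left rfl
  have hg₂ : ContDiff ℝ (⊤ : ℕ∞) (Complex.ofRealCLM ∘ g) := by fun_prop
  set φ := hg₁.toSchwartzMap hg₂
  have h := congrArg (fun F : 𝓢'(Rn n, ℂ) => F φ)
    (Lp.fourierInv_toTemperedDistribution_eq (hf2.toLp f))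
  simp only [TemperedDistribution.fourierInv_apply, Lp.toTemperedDistribution_apply] at h
  have h2 := integral_fourier_mul_eq (f := f) (g := fun x => φ (-x)) hf φ.integrable.comp_neg
  calc _ = ∫ x, φ x • (𝓕⁻ (hf2.toLp f) : L2 n) x := rfl
    _ = ∫ x, f x * 𝓕⁻ (φ : Rn n → ℂ) x := by
        rw [← h]
        apply integral_congr_ae
        filter_upwards [hf2.coeFn_toLp] with x hx
        rw [hx, smul_eq_mul, mul_comm, SchwartzMap.fourierInv_coe]
    _ = ∫ x, f x * 𝓕 (fun x => φ (-x)) x := by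
        rw [← Real.fourierInv_eq_fourier_comp_neg]
    _ = ∫ x, 𝓕 f (-x) * φ (- -x) := by
        rw [← h2, ← integral_neg_eq_self]
    _ = _ := by
        congr 1
        ext x
        rw [neg_neg, mul_comm, fourierInv_eq_fourier_comp]
        rfl

/-- The Fourier transform of `L²` is self-adjoint with respect to the bilinear pairing. -/
lemma integral_fourier_mul_eq_L2 (h f : L2 n) :
    ∫ x, (𝓕 h : L2 n) x * f x = ∫ x, h x * (𝓕 f : L2 n) x := by
  have hh : ENNReal.HolderConjugate 2 2 := inferInstance
  have key : ∀ a b : L2 n, (ContinuousLinearMap.mul ℂ ℂ).lpPairing volume 2 2 a b =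
      ∫ x, a x * b x := fun a b =>
    (ContinuousLinearMap.mul ℂ ℂ).lpPairing_eq_integral a b
  rw [← key, ← key]
  -- Both sides are continuous in f, so Schwartz functions suffice; for them the identity is the
  -- definition of the distributional transform.
  apply DenseRange.induction_on (p := fun f : L2 n =>
      (ContinuousLinearMap.mul ℂ ℂ).lpPairing volume 2 2 (𝓕 h) f =
        (ContinuousLinearMap.mul ℂ ℂ).lpPairing volume 2 2 h (𝓕 f))
    (SchwartzMap.denseRange_toLpCLM (p := 2) ENNReal.ofNat_ne_top) f
  · exact isClosed_eq (ContinuousLinearMap.continuous _)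
      (((ContinuousLinearMap.mul ℂ ℂ).lpPairing volume 2 2 h).continuous.comp
        (FourierTransform.fourierCLM ℂ (L2 n)).continuous)
  · intro φ
    have e := congrArg (fun F : 𝓢'(Rn n, ℂ) => F φ) (Lp.fourier_toTemperedDistribution_eq h)
    simp only [TemperedDistribution.fourier_apply, Lp.toTemperedDistribution_apply] at e
    rw [key, key, SchwartzMap.toLpCLM_apply, SchwartzMap.toLp_fourier_eq]
    calc _ = ∫ x, φ x • (𝓕 h : L2 n) x := by
          apply integral_congr_ae
          filter_upwards [φ.coeFn_toLp 2 volume] with x hx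
          rw [hx, smul_eq_mul, mul_comm]
      _ = _ := by
          rw [← e]
          apply integral_congr_ae
          filter_upwards [(𝓕 φ).coeFn_toLp 2 volume] with x hx
          rw [hx, smul_eq_mul, mul_comm]

/-- The convolution theorem, for a kernel whose Fourier transform is in `L¹ ∩ L²`. -/
lemma convolution_fourierInv_eq {h : Rn n → ℂ} (hh : Integrable h) (hh2 : MemLp h 2) (f : L2 n)
    (x : Rn n) :
    ((𝓕⁻ h) ⋆[ContinuousLinearMap.mul ℂ ℂ, volume] (f : Rn n → ℂ)) x =
      𝓕⁻ (fun η => h η * (𝓕 f : L2 n) η) x := by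
  set e : Rn n → ℂ := fun η => Complex.exp ((2 * Real.pi * inner ℝ η x : ℝ) * Complex.I)
  have hec : Continuous e := by fun_prop
  have hen : ∀ η, ‖e η‖ = 1 := fun η => Complex.norm_exp_ofReal_mul_I _
  -- Modulation turns the reflected, translated kernel s ↦ 𝓕⁻ h (x - s) into 𝓕 k, so the convolution
  -- at x is a bilinear L² pairing.
  set k : Rn n → ℂ := fun η => e η * h η with hk
  have hki : Integrable k := hh.bdd_mul hec.aestronglyMeasurable
    (Eventually.of_forall fun η => (hen η).le)
  have hk2 : MemLp k 2 := hh2.of_le (hec.aestronglyMeasurable.mul hh2.1)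
    (Eventually.of_forall fun η => by simp [k, hen])
  have h1 : ∀ s, 𝓕⁻ h (x - s) = 𝓕 k s := fun s => by
    rw [Real.fourierInv_eq', Real.fourier_eq']
    congr 1
    ext η
    simp only [k, e, smul_eq_mul]
    rw [← mul_assoc, ← Complex.exp_add]
    congr 2
    rw [inner_sub_right]
    push_cast
    ring
  rw [convolution_eq_swap]
  simp only [ContinuousLinearMap.mul_apply']
  calc ∫ s, 𝓕⁻ h (x - s) * f s = ∫ s, (𝓕 (hk2.toLp k) : L2 n) s * f s := by
        apply integral_congr_ae
        filter_upwards [coeFn_fourier_toLp hki hk2] with s hs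
        rw [hs, h1]
    _ = ∫ η, hk2.toLp k η * (𝓕 f : L2 n) η := integral_fourier_mul_eq_L2 _ _
    _ = _ := by
        rw [Real.fourierInv_eq']
        apply integral_congr_ae
        filter_upwards [hk2.coeFn_toLp] with η hη
        rw [hη, smul_eq_mul, hk, mul_assoc]

/-- The symbol `exp(-τ (α|ξ|)^s)` of the mollifier. -/
noncomputable def mollSymbol (τ s α : ℝ) (η : Rn n) : ℝ :=
  Real.exp (-τ * (α * angFreq η) ^ s)

lemma mollSymbol_pos (τ s α : ℝ) (η : Rn n) : 0 < mollSymbol τ s α η := Real.exp_pos _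

lemma mollSymbol_le_one {τ s α : ℝ} (hτ : 0 < τ) (hα : 0 < α) (η : Rn n) :
    mollSymbol τ s α η ≤ 1 := by
  rw [mollSymbol, Real.exp_le_one_iff]
  have := Real.rpow_nonneg (mul_nonneg hα.le (angFreq_nonneg η)) s
  nlinarith

lemma continuous_mollSymbol {τ s : ℝ} (hs : 0 < s) (α : ℝ) :
    Continuous (mollSymbol τ s α : Rn n → ℝ) := by
  unfold mollSymbol
  have : Continuous fun η : Rn n => (α * angFreq η) ^ s :=
    (Real.continuous_rpow_const hs.le).comp (by fun_prop)
  fun_prop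

/-- Change of variables η ↦ αη, whose Jacobian is the factor α^(-n). -/
lemma scaledKernel_eq {τ s α : ℝ} (hα : 0 < α) :
    (scaledKernel τ s α : Rn n → ℂ) = 𝓕⁻ (fun η => (mollSymbol τ s α η : ℂ)) := by
  ext x
  rw [scaledKernel, kernel, Real.fourierInv_eq', Real.fourierInv_eq']
  have := Measure.integral_comp_smul_of_nonneg (volume : Measure (Rn n)) (fun v : Rn n =>
    Complex.exp ((2 * Real.pi * inner ℝ v (α⁻¹ • x) : ℝ) * Complex.I) •
      ((Real.exp (-τ * angFreq v ^ s) : ℝ) : ℂ)) α (hR := hα.le)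
  rw [finrank_euclideanSpace_fin] at this
  rw [← Complex.real_smul, ← this]
  congr 1
  ext η
  rw [real_inner_smul_left, real_inner_smul_right, mul_inv_cancel_left₀ hα.ne', mollSymbol]
  congr 4
  rw [angFreq, angFreq, norm_smul, Real.norm_eq_abs, abs_of_pos hα]
  ring_nf

/-- Powers are dominated by stretched exponentials. -/
lemma exists_rpow_mul_exp_neg_le {τ s q : ℝ} (hτ : 0 < τ) (hs : 0 < s) (hq : 0 ≤ q) :
    ∃ C : ℝ, 0 < C ∧ ∀ x : ℝ, 0 ≤ x → x ^ q * Real.exp (-τ * x ^ s) ≤ C := by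
  -- With y = x^s, the power y^(q/s) is at most 1 + y^k, and y^k is dominated by one term of the
  -- series of exp(τy).
  obtain ⟨k, hk⟩ := exists_nat_ge (q / s)
  refine ⟨1 + k.factorial / τ ^ k, by positivity, fun x hx => ?_⟩
  set y := x ^ s
  have hy : 0 ≤ y := Real.rpow_nonneg hx s
  have h1 : x ^ q = y ^ (q / s) := by
    rw [← Real.rpow_mul hx, mul_div_cancel₀ _ hs.ne']
  have h2 : y ^ (q / s) ≤ 1 + y ^ k := by
    rcases le_total y 1 with h | h
    · have := Real.rpow_le_one hy h (div_nonneg hq hs.le)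
      have : 0 ≤ y ^ k := by positivity
      linarith
    · have := Real.rpow_le_rpow_of_exponent_le h hk
      rw [Real.rpow_natCast] at this
      linarith
  have h3 := Real.pow_div_factorial_le_exp (τ * y) (by positivity) k
  have h4 : y ^ k ≤ k.factorial / τ ^ k * Real.exp (τ * y) := by
    rw [div_le_iff₀ (by positivity), mul_pow] at h3
    rw [div_mul_eq_mul_div, le_div_iff₀ (by positivity)]
    linarith
  have h5 : 1 ≤ Real.exp (τ * y) := Real.one_le_exp (by positivity)
  rw [h1, neg_mul, Real.exp_neg, ← div_eq_mul_inv, div_le_iff₀ (Real.exp_pos _)]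
  linarith

/-- Comparison with (1+‖η‖)^(-(n+1)), which is integrable in dimension n. -/
lemma integrable_mollSymbol {τ s α : ℝ} (hτ : 0 < τ) (hs : 0 < s) (hα : 0 < α) :
    Integrable (mollSymbol τ s α : Rn n → ℝ) := by
  obtain ⟨C, hC, hCb⟩ := exists_rpow_mul_exp_neg_le (q := ((n + 1 : ℕ) : ℝ)) hτ hs (by positivity)
  set β := α * (2 * Real.pi)
  have hβ : 0 < β := by positivity
  have hint := (integrable_one_add_norm (E := Rn n) (μ := volume) (r := ((n + 1 : ℕ) : ℝ))
    (by simp)).const_mul (2 ^ n * (1 + C / β ^ (n + 1)))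
  refine hint.mono' (continuous_mollSymbol hs α).aestronglyMeasurable
    (Eventually.of_forall fun η => ?_)
  have hm := mollSymbol_pos τ s α η
  rw [Real.norm_eq_abs, abs_of_pos hm, Real.rpow_neg (by positivity), Real.rpow_natCast,
    ← div_eq_mul_inv, le_div_iff₀ (by positivity)]
  have h1 := hCb (β * ‖η‖) (by positivity)
  rw [Real.rpow_natCast, mul_pow] at h1
  have h2 : mollSymbol τ s α η = Real.exp (-τ * (β * ‖η‖) ^ s) := by
    rw [mollSymbol, angFreq, ← mul_assoc]
  have h3 : ‖η‖ ^ (n + 1) * mollSymbol τ s α η ≤ C / β ^ (n + 1) := by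
    rw [le_div_iff₀ (by positivity), h2]
    linarith
  have h4 := add_pow_le zero_le_one (norm_nonneg η) (n + 1)
  rw [one_pow, Nat.add_sub_cancel] at h4
  have h5 := mollSymbol_le_one (s := s) hτ hα η
  calc mollSymbol τ s α η * (1 + ‖η‖) ^ (n + 1)
      ≤ mollSymbol τ s α η * (2 ^ n * (1 + ‖η‖ ^ (n + 1))) := by gcongr
    _ = 2 ^ n * (mollSymbol τ s α η + ‖η‖ ^ (n + 1) * mollSymbol τ s α η) := by ring
    _ ≤ _ := by gcongr

lemma memLp_mollSymbol {τ s α : ℝ} (hτ : 0 < τ) (hs : 0 < s) (hα : 0 < α) :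
    MemLp (fun η : Rn n => (mollSymbol τ s α η : ℂ)) 2 := by
  have hc : Continuous (mollSymbol τ s α : Rn n → ℝ) := continuous_mollSymbol hs α
  rw [memLp_two_iff_integrable_sq_norm (by fun_prop)]
  refine (integrable_mollSymbol hτ hs hα).mono' (by fun_prop) (Eventually.of_forall fun η => ?_)
  have h1 := mollSymbol_pos τ s α η
  have h2 := mollSymbol_le_one (s := s) hτ hα η
  rw [Complex.norm_real, norm_pow, norm_norm, Real.norm_eq_abs, abs_of_pos h1]
  nlinarith

lemma memLp_mollSymbol_mul {τ s α : ℝ} (hτ : 0 < τ) (hs : 0 < s) (hα : 0 < α) (f : L2 n) :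
    MemLp (fun η : Rn n => (mollSymbol τ s α η : ℂ) * f η) 2 := by
  have hc : Continuous (mollSymbol τ s α : Rn n → ℝ) := continuous_mollSymbol hs α
  refine (Lp.memLp f).of_le (AEStronglyMeasurable.mul (by fun_prop) (Lp.memLp f).1)
    (Eventually.of_forall fun η => ?_)
  rw [norm_mul, Complex.norm_real, Real.norm_eq_abs, abs_of_pos (mollSymbol_pos τ s α η)]
  exact mul_le_of_le_one_left (norm_nonneg _) (mollSymbol_le_one hτ hα η)

/-- The mollifier is the Fourier multiplier with symbol `exp(-τ (α|ξ|)^s)`. -/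
lemma mollify_ae_eq {τ s α : ℝ} (hτ : 0 < τ) (hs : 0 < s) (hα : 0 < α) (f : L2 n) :
    ∀ᵐ x, mollify τ s α f x =
      (𝓕⁻ ((memLp_mollSymbol_mul hτ hs hα (𝓕 f : L2 n)).toLp _) : L2 n) x := by
  have hi : Integrable fun η : Rn n => (mollSymbol τ s α η : ℂ) * (𝓕 f : L2 n) η :=
    (memLp_mollSymbol hτ hs hα).integrable_mul (Lp.memLp (𝓕 f : L2 n))
  filter_upwards [coeFn_fourierInv_toLp hi (memLp_mollSymbol_mul hτ hs hα (𝓕 f : L2 n))] with x hx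
  have hm : Integrable fun η : Rn n => (mollSymbol τ s α η : ℂ) :=
    (integrable_mollSymbol hτ hs hα).ofReal
  rw [hx, mollify, scaledKernel_eq hα, convolution_fourierInv_eq hm (memLp_mollSymbol hτ hs hα)]

/-- The residual of the mollifier, by Plancherel's theorem. -/
lemma eLpNorm_sub_mollify {τ s α : ℝ} (hτ : 0 < τ) (hs : 0 < s) (hα : 0 < α) (f : L2 n) :
    eLpNorm (fun x => f x - mollify τ s α f x) 2 volume =
      eLpNorm (fun η => ((1 - mollSymbol τ s α η : ℝ) : ℂ) * (𝓕 f : L2 n) η) 2 volume := by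
  set m : L2 n := (memLp_mollSymbol_mul hτ hs hα (𝓕 f : L2 n)).toLp _
  have h1 : eLpNorm (fun x => f x - mollify τ s α f x) 2 volume = ‖f - 𝓕⁻ m‖ₑ := by
    rw [Lp.enorm_def]
    apply eLpNorm_congr_ae
    filter_upwards [mollify_ae_eq hτ hs hα f, Lp.coeFn_sub f (𝓕⁻ m)] with x h1 h2
    rw [h1, h2]
    rfl
  have h2 : ‖f - 𝓕⁻ m‖ₑ = ‖(𝓕 f : L2 n) - m‖ₑ := by
    have : (𝓕 f : L2 n) - m = 𝓕 (f - 𝓕⁻ m) := by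
      rw [sub_eq_add_neg, sub_eq_add_neg, FourierTransform.fourier_add,
        FourierTransform.fourier_neg, FourierTransform.fourier_fourierInv_eq]
    rw [this, ← ofReal_norm, ← ofReal_norm, Lp.norm_fourier_eq]
  rw [h1, h2, Lp.enorm_def]
  apply eLpNorm_congr_ae
  filter_upwards [Lp.coeFn_sub (𝓕 f : L2 n) m,
    (memLp_mollSymbol_mul hτ hs hα (𝓕 f : L2 n)).coeFn_toLp] with η h1 h2
  rw [h1, Pi.sub_apply, h2]
  push_cast
  ring

end FracDiffusion

namespace FracDiffusion

/-! ### Pointwise bounds for the symbols -/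

variable {n : ℕ}

/-- The weight `(1 + |ξ|²)^(r/2)` of the Sobolev norm of order `r`. -/
noncomputable def sobWeight (r : ℝ) (η : Rn n) : ℝ := (1 + angFreq η ^ 2) ^ (r / 2)

/-- The symbol `E_{γ,1}(-|ξ|² t^γ)` of the solution operator. -/
noncomputable def mlSymbol (γ t : ℝ) (η : Rn n) : ℝ :=
  mittagLeffler γ (-(angFreq η ^ 2) * t ^ γ)

lemma sobWeight_pos (r : ℝ) (η : Rn n) : 0 < sobWeight r η := by
  unfold sobWeight; positivity

lemma one_le_sobWeight {r : ℝ} (hr : 0 ≤ r) (η : Rn n) : 1 ≤ sobWeight r η :=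
  Real.one_le_rpow (by nlinarith [sq_nonneg (angFreq η)]) (by linarith)

lemma sobWeight_two (η : Rn n) : sobWeight 2 η = 1 + angFreq η ^ 2 := by simp [sobWeight]

lemma sobWeight_add (r s : ℝ) (η : Rn n) :
    sobWeight (r + s) η = sobWeight r η * sobWeight s η := by
  rw [sobWeight, add_div, Real.rpow_add (by positivity)]
  rfl

@[fun_prop]
lemma continuous_sobWeight (r : ℝ) : Continuous (sobWeight r : Rn n → ℝ) := by
  unfold sobWeight
  exact Continuous.rpow_const (by fun_prop) fun η => Or.inl (by positivity)

lemma continuous_mlSymbol {γ : ℝ} (hγ : 0 < γ) (t : ℝ) :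
    Continuous (mlSymbol γ t : Rn n → ℝ) := by
  unfold mlSymbol
  exact (continuous_mittagLeffler hγ).comp (by fun_prop)

lemma mlSymbol_bounds {γ t : ℝ} (hγ0 : 0 < γ) (hγ1 : γ < 1) (ht : 0 ≤ t) (η : Rn n) :
    0 < mlSymbol γ t η ∧ mlSymbol γ t η ≤ 1 ∧
      1 ≤ mlSymbol γ t η * (1 + Real.Gamma (1 - γ) * (angFreq η ^ 2 * t ^ γ)) ∧
      mlSymbol γ t η * (1 + (Real.Gamma (γ + 1))⁻¹ * (angFreq η ^ 2 * t ^ γ)) ≤ 1 := by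
  rw [mlSymbol, neg_mul]
  exact mittagLeffler_neg_bounds hγ0 hγ1 (by positivity)

/-- The symbol `E_{γ,1}(-|ξ|² t^γ) / E_{γ,1}(-|ξ|² T^γ)` grows at most like `1 + |ξ|²`. -/
lemma mlSymbol_div_le {γ t T : ℝ} (hγ0 : 0 < γ) (hγ1 : γ < 1) (ht : 0 ≤ t) (hT : 0 ≤ T)
    (η : Rn n) :
    mlSymbol γ t η / mlSymbol γ T η ≤ (1 + Real.Gamma (1 - γ) * T ^ γ) * sobWeight 2 η := by
  obtain ⟨h1, h2, -, -⟩ := mlSymbol_bounds hγ0 hγ1 ht η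
  obtain ⟨h3, -, h4, -⟩ := mlSymbol_bounds hγ0 hγ1 hT η
  have hG := Real.Gamma_pos_of_pos (sub_pos.2 hγ1)
  rw [div_le_iff₀ h3, sobWeight_two]
  refine h2.trans (h4.trans ?_)
  rw [mul_comm]
  apply mul_le_mul_of_nonneg_right _ h3.le
  have : 0 ≤ Real.Gamma (1 - γ) * T ^ γ := by positivity
  nlinarith [sq_nonneg (angFreq η)]

/-- The symbol `E_{γ,1}(-|ξ|² T^γ)` decays like `1 / (1 + |ξ|²)`. -/
lemma sq_mul_mlSymbol_le {γ T : ℝ} (hγ0 : 0 < γ) (hγ1 : γ < 1) (hT : 0 < T) (η : Rn n) :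
    angFreq η ^ 2 * mlSymbol γ T η ≤ Real.Gamma (γ + 1) / T ^ γ := by
  obtain ⟨h3, -, -, h4⟩ := mlSymbol_bounds hγ0 hγ1 hT.le η
  have hG := Real.Gamma_pos_of_pos (by linarith : 0 < γ + 1)
  have hTγ := Real.rpow_pos_of_pos hT γ
  rw [le_div_iff₀ hTγ]
  rw [mul_add, mul_one] at h4
  have h5 : mlSymbol γ T η * ((Real.Gamma (γ + 1))⁻¹ * (angFreq η ^ 2 * T ^ γ)) ≤ 1 := by linarith
  have h6 := mul_le_mul_of_nonneg_left h5 hG.le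
  have h7 : Real.Gamma (γ + 1) *
      (mlSymbol γ T η * ((Real.Gamma (γ + 1))⁻¹ * (angFreq η ^ 2 * T ^ γ))) =
      angFreq η ^ 2 * mlSymbol γ T η * T ^ γ := by
    field_simp
  linarith

/-- Homogeneous powers of |ξ| scale to α^(-q). The extra 1 accounts for low frequencies and is
needed because α may be large. -/
lemma exists_sobWeight_mul_mollSymbol_le {τ s q : ℝ} (hτ : 0 < τ) (hs : 0 < s) (hq : 0 ≤ q) :
    ∃ C : ℝ, 0 < C ∧ ∀ α : ℝ, 0 < α → ∀ η : Rn n,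
      sobWeight q η * mollSymbol τ s α η ≤ C * (1 + (α ^ q)⁻¹) := by
  obtain ⟨C, hC, hb⟩ := exists_rpow_mul_exp_neg_le hτ hs hq
  refine ⟨2 ^ q * (1 + C), by positivity, fun α hα η => ?_⟩
  have hx := angFreq_nonneg η
  have hm := mollSymbol_pos τ s α η
  have hm1 := mollSymbol_le_one (s := s) hτ hα η
  have hαq : 0 < α ^ q := Real.rpow_pos_of_pos hα q
  have h1 : angFreq η ^ q * mollSymbol τ s α η ≤ C * (α ^ q)⁻¹ := by
    have := hb (α * angFreq η) (by positivity)
    rw [Real.mul_rpow hα.le hx] at this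
    rw [← div_eq_mul_inv, le_div_iff₀ hαq, mollSymbol]
    linarith
  have h2 : sobWeight q η ≤ 2 ^ q * (1 + angFreq η ^ q) := by
    have hle : sobWeight q η ≤ (1 + angFreq η) ^ q := by
      have : (1 + angFreq η) ^ q = ((1 + angFreq η) ^ 2) ^ (q / 2) := by
        rw [← Real.rpow_natCast, ← Real.rpow_mul (by positivity)]
        congr 1
        push_cast
        ring
      rw [this, sobWeight]
      exact Real.rpow_le_rpow (by positivity) (by nlinarith) (by linarith)
    have hxq := Real.rpow_nonneg hx q
    rcases le_total (angFreq η) 1 with h | h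
    · calc sobWeight q η ≤ (1 + angFreq η) ^ q := hle
        _ ≤ 2 ^ q := Real.rpow_le_rpow (by positivity) (by linarith) hq
        _ ≤ 2 ^ q * (1 + angFreq η ^ q) := le_mul_of_one_le_right (by positivity) (by linarith)
    · calc sobWeight q η ≤ (1 + angFreq η) ^ q := hle
        _ ≤ (2 * angFreq η) ^ q := Real.rpow_le_rpow (by positivity) (by linarith) hq
        _ = 2 ^ q * angFreq η ^ q := Real.mul_rpow (by norm_num) hx
        _ ≤ 2 ^ q * (1 + angFreq η ^ q) := by gcongr; linarith
  have hinv : 0 < (α ^ q)⁻¹ := inv_pos.2 hαq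
  calc sobWeight q η * mollSymbol τ s α η
      ≤ 2 ^ q * (1 + angFreq η ^ q) * mollSymbol τ s α η := by gcongr
    _ = 2 ^ q * (mollSymbol τ s α η + angFreq η ^ q * mollSymbol τ s α η) := by ring
    _ ≤ 2 ^ q * (1 + C * (α ^ q)⁻¹) := by gcongr
    _ ≤ 2 ^ q * ((1 + C) * (1 + (α ^ q)⁻¹)) := by gcongr; nlinarith
    _ = _ := by ring

/-- For y = α|ξ| ≤ 1, 1 - exp(-τy^s) ≤ τy^s ≤ τy^q since q ≤ s; for y ≥ 1 the left side is below 1 ≤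
y^q. -/
lemma one_sub_mollSymbol_le {τ s q α : ℝ} (hτ : 0 < τ) (hq : 0 ≤ q) (hqs : q ≤ s) (hα : 0 < α)
    (η : Rn n) : 1 - mollSymbol τ s α η ≤ (1 + τ) * α ^ q * angFreq η ^ q := by
  have hx := angFreq_nonneg η
  rw [mul_assoc, ← Real.mul_rpow hα.le hx]
  set y := α * angFreq η with hy
  have hy0 : 0 ≤ y := by positivity
  have hyq := Real.rpow_nonneg hy0 q
  rcases le_total y 1 with h | h
  · have h1 := Real.add_one_le_exp (-τ * y ^ s)
    have h2 : y ^ s ≤ y ^ q := by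
      rcases hy0.eq_or_lt with h0 | h0
      · rcases hq.eq_or_lt with h3 | h3
        · rw [← h3, Real.rpow_zero]
          exact Real.rpow_le_one hy0 h (by linarith)
        · rw [← h0, Real.zero_rpow h3.ne', Real.zero_rpow (h3.trans_le hqs).ne']
      · exact Real.rpow_le_rpow_of_exponent_ge h0 h hqs
    rw [mollSymbol, ← hy]
    nlinarith
  · have h1 := mollSymbol_pos τ s α η
    have h2 := Real.one_le_rpow h hq
    nlinarith

/-- The smoothing symbol of the residual `(1 - M_α) g` compensates for `α^(-(p+2))`. -/
lemma one_sub_mollSymbol_mul_mlSymbol_le {γ T τ s p α : ℝ} (hγ0 : 0 < γ) (hγ1 : γ < 1)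
    (hT : 0 < T) (hτ : 0 < τ) (hp : 0 < p) (hps : p + 2 ≤ s) (hα : 0 < α) (η : Rn n) :
    (1 - mollSymbol τ s α η) * mlSymbol γ T η ≤
      (1 + τ) * (Real.Gamma (γ + 1) / T ^ γ) * α ^ (p + 2) * sobWeight p η := by
  have hx := angFreq_nonneg η
  have h0 := (sobWeight_pos p η).le
  have h1 := one_sub_mollSymbol_le hτ (by linarith : 0 ≤ p + 2) hps hα η
  have h2 := sq_mul_mlSymbol_le hγ0 hγ1 hT η
  have h3 := (mlSymbol_bounds hγ0 hγ1 hT.le η).1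
  have hG := Real.Gamma_pos_of_pos (by linarith : 0 < γ + 1)
  have h4 : angFreq η ^ p ≤ sobWeight p η := by
    have : angFreq η ^ p = (angFreq η ^ 2) ^ (p / 2) := by
      rw [← Real.rpow_natCast, ← Real.rpow_mul hx]
      congr 1
      push_cast
      ring
    rw [this, sobWeight]
    exact Real.rpow_le_rpow (by positivity) (by linarith) (by linarith)
  have h5 : angFreq η ^ (p + 2) = angFreq η ^ p * angFreq η ^ 2 := by
    rw [Real.rpow_add' hx (by linarith), Real.rpow_two]
  -- Of the p+2 powers of |ξ|, two are absorbed by the decay of e_T and p by the Sobolev weight.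
  calc (1 - mollSymbol τ s α η) * mlSymbol γ T η
      ≤ (1 + τ) * α ^ (p + 2) * angFreq η ^ (p + 2) * mlSymbol γ T η := by gcongr
    _ = (1 + τ) * α ^ (p + 2) * (angFreq η ^ p * (angFreq η ^ 2 * mlSymbol γ T η)) := by
        rw [h5]; ring
    _ ≤ (1 + τ) * α ^ (p + 2) * (sobWeight p η * (Real.Gamma (γ + 1) / T ^ γ)) := by gcongr
    _ = _ := by ring

/-! ### Interpolation -/

/-- Interpolation between weighted `L²` norms. -/
lemma eLpNorm_sobWeight_interpolation {F : Rn n → ℂ} (hF : AEStronglyMeasurable F volume)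
    {a b r r₁ r₂ : ℝ} (ha : 0 ≤ a) (hb : 0 ≤ b) (hab : a + b = 1) (hr : r = r₁ * a + r₂ * b) :
    eLpNorm (fun η => (sobWeight r η : ℂ) * F η) 2 volume ≤
      eLpNorm (fun η => (sobWeight r₁ η : ℂ) * F η) 2 volume ^ a *
      eLpNorm (fun η => (sobWeight r₂ η : ℂ) * F η) 2 volume ^ b := by
  have hnorm : ∀ (r : ℝ) (η : Rn n), ‖(sobWeight r η : ℂ) * F η‖ₑ =
      ENNReal.ofReal (1 + angFreq η ^ 2) ^ (r / 2) * ‖F η‖ₑ := fun r η => by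
    rw [enorm_mul, ENNReal.ofReal_rpow_of_pos (by positivity), ← ofReal_norm,
      Complex.norm_real, Real.norm_eq_abs, abs_of_pos (sobWeight_pos r η), sobWeight]
  have hpt : ∀ η : Rn n, ‖(sobWeight r η : ℂ) * F η‖ₑ ^ (2 : ℝ) =
      (‖(sobWeight r₁ η : ℂ) * F η‖ₑ ^ (2 : ℝ)) ^ a *
      (‖(sobWeight r₂ η : ℂ) * F η‖ₑ ^ (2 : ℝ)) ^ b := fun η => by
    rw [← ENNReal.rpow_mul, ← ENNReal.rpow_mul, mul_comm 2 a, mul_comm 2 b, ENNReal.rpow_mul,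
      ENNReal.rpow_mul, ← ENNReal.mul_rpow_of_nonneg _ _ zero_le_two]
    congr 1
    rw [hnorm, hnorm, hnorm, ENNReal.mul_rpow_of_nonneg _ _ ha, ENNReal.mul_rpow_of_nonneg _ _ hb,
      ← ENNReal.rpow_mul, ← ENNReal.rpow_mul, mul_mul_mul_comm,
      ← ENNReal.rpow_add _ _ (by simp; positivity) ENNReal.ofReal_ne_top,
      ← ENNReal.rpow_add_of_nonneg _ _ ha hb, hab, ENNReal.rpow_one, hr]
    congr 2
    ring
  have hm : ∀ r : ℝ, AEMeasurable (fun η => ‖(sobWeight r η : ℂ) * F η‖ₑ ^ (2 : ℝ)) volume :=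
    fun r => by
      have : AEStronglyMeasurable (fun η : Rn n => (sobWeight r η : ℂ)) volume :=
        Continuous.aestronglyMeasurable (by fun_prop)
      exact (this.mul hF).enorm.pow_const _
  simp only [eLpNorm_eq_lintegral_rpow_enorm_toReal two_ne_zero ENNReal.ofNat_ne_top,
    ENNReal.toReal_ofNat]
  rw [← ENNReal.rpow_mul, ← ENNReal.rpow_mul, mul_comm _ a, mul_comm _ b, ENNReal.rpow_mul,
    ENNReal.rpow_mul, ← ENNReal.mul_rpow_of_nonneg _ _ (by positivity)]
  apply ENNReal.rpow_le_rpow _ (by positivity)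
  simp_rw [hpt]
  -- Hölder's inequality with exponents 1/a and 1/b, applied to the squared densities.
  exact ENNReal.lintegral_mul_norm_pow_le (hm r₁) (hm r₂) ha hb hab

end FracDiffusion

namespace FracDiffusion

/-! ### The error estimate -/

variable {n : ℕ}

lemma eLpNorm_symbol_mul_le {a b : Rn n → ℝ} {c : ℝ} (h : ∀ η, |a η| ≤ c * |b η|)
    (f : Rn n → ℂ) :
    eLpNorm (fun η => (a η : ℂ) * f η) 2 volume ≤
      ENNReal.ofReal c * eLpNorm (fun η => (b η : ℂ) * f η) 2 volume := by
  apply eLpNorm_le_mul_eLpNorm_of_ae_le_mul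
  refine Eventually.of_forall fun η => ?_
  rw [norm_mul, norm_mul, Complex.norm_real, Complex.norm_real, ← mul_assoc]
  exact mul_le_mul_of_nonneg_right (h η) (norm_nonneg _)

lemma eLpNorm_symbol_mul_le_const {a : Rn n → ℝ} {c : ℝ} (h : ∀ η, |a η| ≤ c)
    (f : Rn n → ℂ) :
    eLpNorm (fun η => (a η : ℂ) * f η) 2 volume ≤ ENNReal.ofReal c * eLpNorm f 2 volume := by
  simpa using eLpNorm_symbol_mul_le (b := fun _ => 1) (by simpa using h) f

lemma aestronglyMeasurable_symbol_mul {a : Rn n → ℝ} (ha : Measurable a) {f : Rn n → ℂ}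
    (hf : AEStronglyMeasurable f volume) :
    AEStronglyMeasurable (fun η => (a η : ℂ) * f η) volume :=
  AEStronglyMeasurable.mul (by fun_prop) hf

lemma sobolevENorm_eq (r : ℝ) (f : L2 n) :
    sobolevENorm r f = eLpNorm (fun η => (sobWeight r η : ℂ) * (𝓕 f : L2 n) η) 2 volume := rfl

lemma eLpNorm_fourier_sub_le {f g : L2 n} {δ : ℝ} (h : ‖f - g‖ ≤ δ) :
    eLpNorm (fun η => (𝓕 f : L2 n) η - (𝓕 g : L2 n) η) 2 volume ≤ ENNReal.ofReal δ := by
  have h1 : (𝓕 f : L2 n) - 𝓕 g = 𝓕 (f - g) := by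
    rw [sub_eq_add_neg, sub_eq_add_neg, FourierTransform.fourier_add, FourierTransform.fourier_neg]
  have h2 : ‖(𝓕 f : L2 n) - 𝓕 g‖ₑ ≤ ENNReal.ofReal δ := by
    rw [h1, ← ofReal_norm, Lp.norm_fourier_eq]
    exact ENNReal.ofReal_le_ofReal h
  rw [Lp.enorm_def] at h2
  refine le_of_eq_of_le (eLpNorm_congr_ae ?_) h2
  filter_upwards [Lp.coeFn_sub (𝓕 f : L2 n) (𝓕 g)] with η hη
  rw [hη, Pi.sub_apply]

lemma abs_one_sub_mollSymbol_le {τ s α : ℝ} (hτ : 0 < τ) (hα : 0 < α) (η : Rn n) :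
    |1 - mollSymbol τ s α η| ≤ 1 := by
  rw [abs_le]
  constructor <;> linarith [mollSymbol_pos τ s α η, mollSymbol_le_one (s := s) hτ hα η]

/-- Consequence of the a-posteriori rule: the noise level is controlled by the residual of the
exact data. -/
lemma noise_le_of_morozov {τ s α θ δ E p c : ℝ} {g gδ v : L2 n} {e : Rn n → ℝ}
    (hτ : 0 < τ) (hs : 0 < s) (hα : 0 < α) (hδ : 0 ≤ δ) (hc : 0 ≤ c) (hE : 0 ≤ E)
    (he : Continuous e) (hg : ∀ᵐ η, (𝓕 g : L2 n) η = (e η : ℂ) * (𝓕 v : L2 n) η)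
    (hv : sobolevENorm p v ≤ ENNReal.ofReal E) (hnoise : ‖g - gδ‖ ≤ δ)
    (hM : eLpNorm (fun x => gδ x - mollify τ s α gδ x) 2 volume = ENNReal.ofReal (θ * δ))
    (hb : ∀ η, |(1 - mollSymbol τ s α η) * e η| ≤ c * sobWeight p η) :
    (θ - 1) * δ ≤ c * E := by
  have hmc : Continuous (mollSymbol τ s α : Rn n → ℝ) := continuous_mollSymbol hs α
  rw [eLpNorm_sub_mollify hτ hs hα] at hM
  have h1 : eLpNorm (fun η => ((1 - mollSymbol τ s α η : ℝ) : ℂ) *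
      ((𝓕 gδ : L2 n) η - (𝓕 g : L2 n) η)) 2 volume ≤ ENNReal.ofReal δ := by
    refine (eLpNorm_symbol_mul_le_const (abs_one_sub_mollSymbol_le hτ hα) _).trans ?_
    rw [ENNReal.ofReal_one, one_mul]
    exact eLpNorm_fourier_sub_le (by rwa [norm_sub_rev])
  have h2 : eLpNorm (fun η => (((1 - mollSymbol τ s α η) * e η : ℝ) : ℂ) * (𝓕 v : L2 n) η) 2
      volume ≤ ENNReal.ofReal (c * E) := by
    refine (eLpNorm_symbol_mul_le (b := sobWeight p) (c := c) (fun η => ?_) _).trans ?_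
    · rw [abs_of_pos (sobWeight_pos p η)]
      exact hb η
    · rw [ENNReal.ofReal_mul hc, ← sobolevENorm_eq]
      gcongr
  -- Splitting the noisy data into noise and exact data e v̂ gives θδ ≤ δ + cE; θ > 1 later makes
  -- this informative.
  have h3 : eLpNorm (fun η => ((1 - mollSymbol τ s α η : ℝ) : ℂ) * (𝓕 gδ : L2 n) η) 2 volume ≤
      ENNReal.ofReal δ + ENNReal.ofReal (c * E) := by
    refine le_trans (le_of_eq (eLpNorm_congr_ae ?_)) ((eLpNorm_add_le
      (aestronglyMeasurable_symbol_mul (by fun_prop)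
        ((Lp.aestronglyMeasurable _).sub (Lp.aestronglyMeasurable _)))
      (aestronglyMeasurable_symbol_mul (by fun_prop) (Lp.aestronglyMeasurable _))
      one_le_two).trans (add_le_add h1 h2))
    filter_upwards [hg] with η hη
    simp only [Pi.add_apply, Pi.sub_apply]
    rw [hη]
    push_cast
    ring
  rw [hM, ← ENNReal.ofReal_add hδ (by positivity), ENNReal.ofReal_le_ofReal_iff (by positivity)]
    at h3
  linarith

lemma regularizedHat_eq (γ T τ s α : ℝ) (gδ : L2 n) (t : ℝ) (η : Rn n) :
    regularizedHat γ T τ s α gδ t η =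
      ((mlSymbol γ t η / mlSymbol γ T η * mollSymbol τ s α η : ℝ) : ℂ) * (𝓕 gδ : L2 n) η := rfl

lemma measurable_mlSymbol_div {γ : ℝ} (hγ : 0 < γ) (t T : ℝ) :
    Measurable fun η : Rn n => mlSymbol γ t η / mlSymbol γ T η :=
  (continuous_mlSymbol hγ t).measurable.div (continuous_mlSymbol hγ T).measurable

/-- Uniform bound for the symbol of the regularized solution operator with values in `Hᵖ`. -/
lemma exists_sobWeight_mul_le {γ T τ s p : ℝ} (hγ0 : 0 < γ) (hγ1 : γ < 1) (hT : 0 < T)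
    (hτ : 0 < τ) (hs : 0 < s) (hp : 0 < p) :
    ∃ C : ℝ, 0 < C ∧ ∀ α, 0 < α → ∀ t, 0 ≤ t → ∀ η : Rn n,
      |sobWeight p η * (mlSymbol γ t η / mlSymbol γ T η * mollSymbol τ s α η)| ≤
        C * (1 + (α ^ (p + 2))⁻¹) := by
  obtain ⟨C, hC, hb⟩ := exists_sobWeight_mul_mollSymbol_le (n := n) (q := p + 2) hτ hs
    (by linarith)
  have hG := Real.Gamma_pos_of_pos (sub_pos.2 hγ1)
  refine ⟨(1 + Real.Gamma (1 - γ) * T ^ γ) * C, by positivity, fun α hα t ht η => ?_⟩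
  have h1 := mlSymbol_div_le hγ0 hγ1 ht hT.le η
  have h2 := (mlSymbol_bounds hγ0 hγ1 ht η).1
  have h3 := (mlSymbol_bounds hγ0 hγ1 hT.le η).1
  have h4 := mollSymbol_pos τ s α η
  have h5 := sobWeight_pos p η
  rw [abs_of_pos (by positivity)]
  calc sobWeight p η * (mlSymbol γ t η / mlSymbol γ T η * mollSymbol τ s α η)
      ≤ sobWeight p η * ((1 + Real.Gamma (1 - γ) * T ^ γ) * sobWeight 2 η *
          mollSymbol τ s α η) := by gcongr
    _ = (1 + Real.Gamma (1 - γ) * T ^ γ) * (sobWeight (p + 2) η * mollSymbol τ s α η) := by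
        rw [sobWeight_add]; ring
    _ ≤ (1 + Real.Gamma (1 - γ) * T ^ γ) * (C * (1 + (α ^ (p + 2))⁻¹)) := by
        exact mul_le_mul_of_nonneg_left (hb α hα η) (by positivity)
    _ = _ := by ring

lemma memLp_regularizedHat {γ T τ s α t : ℝ} (hγ0 : 0 < γ) (hγ1 : γ < 1) (hT : 0 < T)
    (hτ : 0 < τ) (hs : 0 < s) (hα : 0 < α) (ht : 0 ≤ t) (gδ : L2 n) :
    MemLp (regularizedHat γ T τ s α gδ t) 2 (volume : Measure (Rn n)) := by
  -- Order 1 is arbitrary: any Sobolev weight of positive order is at least 1.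
  obtain ⟨C, hC, hb⟩ := exists_sobWeight_mul_le (n := n) (p := 1) hγ0 hγ1 hT hτ hs one_pos
  have hm : Continuous (mollSymbol τ s α : Rn n → ℝ) := continuous_mollSymbol hs α
  have hr := measurable_mlSymbol_div (n := n) hγ0 t T
  refine (Lp.memLp (𝓕 gδ : L2 n)).of_le_mul (c := C * (1 + (α ^ ((1 : ℝ) + 2))⁻¹))
    (aestronglyMeasurable_symbol_mul (hr.mul hm.measurable) (Lp.aestronglyMeasurable _))
    (Eventually.of_forall fun η => ?_)
  rw [regularizedHat_eq, norm_mul, Complex.norm_real, Real.norm_eq_abs]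
  gcongr
  refine le_trans ?_ (hb α hα t ht η)
  rw [abs_mul (sobWeight 1 η), abs_of_pos (sobWeight_pos _ _)]
  exact le_mul_of_one_le_left (abs_nonneg _) (one_le_sobWeight zero_le_one η)

lemma coeFn_fourier_sub_regularizedSolution {γ T τ s α t : ℝ} {gδ : L2 n}
    (h : MemLp (regularizedHat γ T τ s α gδ t) 2 (volume : Measure (Rn n))) (v : L2 n) :
    ∀ᵐ η, (𝓕 (v - regularizedSolution γ T τ s α gδ t) : L2 n) η =
      (𝓕 v : L2 n) η - regularizedHat γ T τ s α gδ t η := by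
  have h1 : (𝓕 (v - regularizedSolution γ T τ s α gδ t) : L2 n) = 𝓕 v - h.toLp _ := by
    rw [regularizedSolution, dif_pos h, sub_eq_add_neg, sub_eq_add_neg,
      FourierTransform.fourier_add, FourierTransform.fourier_neg,
      FourierTransform.fourier_fourierInv_eq]
  rw [h1]
  filter_upwards [Lp.coeFn_sub (𝓕 v : L2 n) (h.toLp _), h.coeFn_toLp] with η h2 h3
  rw [h2, Pi.sub_apply, h3]

/-- The error in the weak norm of `H⁻²`. -/
lemma eLpNorm_error_neg_two_le {γ T τ s α θ δ t : ℝ} {g gδ : L2 n} {F : Rn n → ℂ}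
    (hγ0 : 0 < γ) (hγ1 : γ < 1) (hT : 0 < T) (hτ : 0 < τ) (hs : 0 < s) (hα : 0 < α)
    (hδ : 0 ≤ δ) (hθ : 0 ≤ θ) (ht : 0 ≤ t) (hnoise : ‖g - gδ‖ ≤ δ)
    (hM : eLpNorm (fun x => gδ x - mollify τ s α gδ x) 2 volume = ENNReal.ofReal (θ * δ))
    (hF : ∀ᵐ η, F η = ((mlSymbol γ t η / mlSymbol γ T η : ℝ) : ℂ) *
      ((𝓕 g : L2 n) η - (mollSymbol τ s α η : ℂ) * (𝓕 gδ : L2 n) η)) :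
    eLpNorm (fun η => (sobWeight (-2) η : ℂ) * F η) 2 volume ≤
      ENNReal.ofReal ((1 + Real.Gamma (1 - γ) * T ^ γ) * (1 + θ) * δ) := by
  have hmc : Continuous (mollSymbol τ s α : Rn n → ℝ) := continuous_mollSymbol hs α
  have hG := Real.Gamma_pos_of_pos (sub_pos.2 hγ1)
  rw [eLpNorm_sub_mollify hτ hs hα] at hM
  -- ĝ - m ĝδ = (ĝ - ĝδ) + (1-m)ĝδ: noise of size δ plus the residual θδ.
  have h1 : eLpNorm (fun η => (𝓕 g : L2 n) η - (mollSymbol τ s α η : ℂ) * (𝓕 gδ : L2 n) η) 2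
      volume ≤ ENNReal.ofReal ((1 + θ) * δ) := by
    rw [add_mul, one_mul, ENNReal.ofReal_add hδ (by positivity), ← hM]
    refine le_trans (le_of_eq (congrArg (fun f => eLpNorm f 2 volume) ?_)) ((eLpNorm_add_le
      ((Lp.aestronglyMeasurable _).sub (Lp.aestronglyMeasurable _))
      (aestronglyMeasurable_symbol_mul (by fun_prop) (Lp.aestronglyMeasurable _))
      one_le_two).trans (add_le_add_left (eLpNorm_fourier_sub_le hnoise) _))
    ext η
    simp only [Pi.add_apply, Pi.sub_apply]
    push_cast
    ring
  have h2 : eLpNorm (fun η => (sobWeight (-2) η : ℂ) * F η) 2 volume =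
      eLpNorm (fun η => ((sobWeight (-2) η * (mlSymbol γ t η / mlSymbol γ T η) : ℝ) : ℂ) *
        ((𝓕 g : L2 n) η - (mollSymbol τ s α η : ℂ) * (𝓕 gδ : L2 n) η)) 2 volume := by
    apply eLpNorm_congr_ae
    filter_upwards [hF] with η hη
    rw [hη]
    push_cast
    ring
  rw [h2, mul_assoc, ENNReal.ofReal_mul (by positivity)]
  refine (eLpNorm_symbol_mul_le_const (fun η => ?_) _).trans (mul_le_mul_right h1 _)
  have h3 := mlSymbol_div_le hγ0 hγ1 ht hT.le η
  have h4 := (mlSymbol_bounds hγ0 hγ1 ht η).1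
  have h5 := (mlSymbol_bounds hγ0 hγ1 hT.le η).1
  have h6 := sobWeight_pos (-2) η
  have h7 : sobWeight (-2) η * sobWeight 2 η = 1 := by
    rw [← sobWeight_add]; simp [sobWeight]
  rw [abs_of_pos (by positivity)]
  calc sobWeight (-2) η * (mlSymbol γ t η / mlSymbol γ T η)
      ≤ sobWeight (-2) η * ((1 + Real.Gamma (1 - γ) * T ^ γ) * sobWeight 2 η) := by gcongr
    _ = (1 + Real.Gamma (1 - γ) * T ^ γ) * (sobWeight (-2) η * sobWeight 2 η) := by ring
    _ = _ := by rw [h7, mul_one]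

/-- The error in the strong norm of `Hᵖ`. -/
lemma eLpNorm_error_le {γ T τ s p α δ E t S : ℝ} {g gδ v : L2 n} {F : Rn n → ℂ}
    (hγ0 : 0 < γ) (hγ1 : γ < 1) (hτ : 0 < τ) (hs : 0 < s) (hα : 0 < α)
    (hδ : 0 ≤ δ) (hE : 0 ≤ E) (hS : 0 ≤ S) (ht : 0 ≤ t) (hnoise : ‖g - gδ‖ ≤ δ)
    (hv : sobolevENorm p v ≤ ENNReal.ofReal E)
    (hb : ∀ η : Rn n,
      |sobWeight p η * (mlSymbol γ t η / mlSymbol γ T η * mollSymbol τ s α η)| ≤ S)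
    (hF : ∀ᵐ η, F η = (((1 - mollSymbol τ s α η) * mlSymbol γ t η : ℝ) : ℂ) * (𝓕 v : L2 n) η +
      ((mlSymbol γ t η / mlSymbol γ T η * mollSymbol τ s α η : ℝ) : ℂ) *
      ((𝓕 g : L2 n) η - (𝓕 gδ : L2 n) η)) :
    eLpNorm (fun η => (sobWeight p η : ℂ) * F η) 2 volume ≤ ENNReal.ofReal (E + S * δ) := by
  have hmc : Continuous (mollSymbol τ s α : Rn n → ℝ) := continuous_mollSymbol hs α
  have hr := measurable_mlSymbol_div (n := n) hγ0 t T
  have he := continuous_mlSymbol (n := n) hγ0 t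
  -- For the regularization error only boundedness in Hᵖ is needed: 1-m and e_t both lie in [0,1].
  have h1 : eLpNorm (fun η => ((sobWeight p η * ((1 - mollSymbol τ s α η) * mlSymbol γ t η) : ℝ) :
      ℂ) * (𝓕 v : L2 n) η) 2 volume ≤ ENNReal.ofReal E := by
    refine (eLpNorm_symbol_mul_le (b := sobWeight p) (c := 1) (fun η => ?_) _).trans ?_
    · rw [abs_mul, abs_mul, one_mul]
      obtain ⟨h2, h3, -, -⟩ := mlSymbol_bounds hγ0 hγ1 ht η
      refine mul_le_of_le_one_right (abs_nonneg _)
        (mul_le_one₀ (abs_one_sub_mollSymbol_le hτ hα η) (abs_nonneg _) ?_)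
      rwa [abs_of_pos h2]
    · rwa [ENNReal.ofReal_one, one_mul, ← sobolevENorm_eq]
  have h2 : eLpNorm (fun η => ((sobWeight p η *
      (mlSymbol γ t η / mlSymbol γ T η * mollSymbol τ s α η) : ℝ) : ℂ) *
      ((𝓕 g : L2 n) η - (𝓕 gδ : L2 n) η)) 2 volume ≤ ENNReal.ofReal (S * δ) := by
    rw [ENNReal.ofReal_mul hS]
    exact (eLpNorm_symbol_mul_le_const hb _).trans
      (mul_le_mul_right (eLpNorm_fourier_sub_le hnoise) _)
  rw [ENNReal.ofReal_add hE (by positivity)]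
  refine le_trans (le_of_eq (eLpNorm_congr_ae ?_)) ((eLpNorm_add_le
    (aestronglyMeasurable_symbol_mul (by fun_prop) (Lp.aestronglyMeasurable _))
    (aestronglyMeasurable_symbol_mul ((continuous_sobWeight p).measurable.mul
      (hr.mul hmc.measurable)) ((Lp.aestronglyMeasurable _).sub (Lp.aestronglyMeasurable _)))
    one_le_two).trans (add_le_add h1 h2))
  filter_upwards [hF] with η hη
  simp only [Pi.add_apply, Pi.sub_apply, Pi.mul_apply]
  rw [hη]
  push_cast
  ring

/-- Since a, b ≤ 1 and K, L ≥ 1, the powers of K and L are bounded by K and L, which makes the final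
constant independent of l. -/
lemma ofReal_rpow_mul_ofReal_rpow_le {K L E δ a b : ℝ} (hK : 1 ≤ K) (hL : 1 ≤ L) (hE : 0 ≤ E)
    (hδ : 0 ≤ δ) (ha : 0 ≤ a) (hb : 0 ≤ b) (hab : a + b = 1) :
    ENNReal.ofReal (K * E) ^ a * ENNReal.ofReal (L * δ) ^ b ≤
      ENNReal.ofReal (K * L * E ^ a * δ ^ b) := by
  have hK0 : 0 ≤ K := by linarith
  have hL0 : 0 ≤ L := by linarith
  rw [ENNReal.ofReal_rpow_of_nonneg (by positivity) ha,
    ENNReal.ofReal_rpow_of_nonneg (by positivity) hb, ← ENNReal.ofReal_mul (by positivity),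
    Real.mul_rpow hK0 hE, Real.mul_rpow hL0 hδ]
  apply ENNReal.ofReal_le_ofReal
  have h1 : K ^ a ≤ K := Real.rpow_le_self_of_one_le hK (by linarith)
  have h2 : L ^ b ≤ L := Real.rpow_le_self_of_one_le hL (by linarith)
  calc K ^ a * E ^ a * (L ^ b * δ ^ b) = K ^ a * L ^ b * E ^ a * δ ^ b := by ring
    _ ≤ _ := by gcongr

end FracDiffusion

/-! ### Choice of constants and conclusion -/

theorem mainTheorem3 (n : ℕ) (γ T τ s p θ : ℝ)
    (hγ0 : 0 < γ) (hγ1 : γ < 1) (hT : 0 < T) (hτ : 0 < τ) (hs : 0 < s) (hp : 0 < p) (hθ : 1 < θ)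
    (hps : p + 2 ≤ s) :
    ∃ C : ℝ, 0 < C ∧
      ∀ (E δ : ℝ) (g : FracDiffusion.L2 n) (u : ℝ → FracDiffusion.L2 n)
        (gδ : FracDiffusion.L2 n) (α : ℝ),
        0 < E →
        FracDiffusion.IsWeakSolution γ T g u →
        FracDiffusion.sobolevENorm p (u 0) ≤ ENNReal.ofReal E →
        ‖g - gδ‖ ≤ δ →
        0 < θ * δ →
        θ * δ < ‖gδ‖ →
        0 < α →
        eLpNorm (fun x => gδ x - FracDiffusion.mollify τ s α gδ x) 2 volume
          = ENNReal.ofReal (θ * δ) →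
        (∀ t ∈ Icc 0 T, MemLp (FracDiffusion.regularizedHat γ T τ s α gδ t) 2 volume) ∧
        ∀ l ∈ Icc 0 p, ∀ t ∈ Icc 0 T,
          FracDiffusion.sobolevENorm l
              (u t - FracDiffusion.regularizedSolution γ T τ s α gδ t)
            ≤ ENNReal.ofReal (C * E ^ ((2 + l) / (p + 2)) * δ ^ ((p - l) / (p + 2))) := by
  open FracDiffusion in
  obtain ⟨A, hA, hAb⟩ := exists_sobWeight_mul_le (n := n) hγ0 hγ1 hT hτ hs hp
  have hG1 := Real.Gamma_pos_of_pos (sub_pos.2 hγ1)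
  have hG2 := Real.Gamma_pos_of_pos (by linarith : 0 < γ + 1)
  have hθ1 : 0 < θ - 1 := by linarith
  set B : ℝ := (1 + τ) * (Real.Gamma (γ + 1) / T ^ γ)
  have hB0 : 0 < B := by positivity
  set K : ℝ := 1 + A * (1 + B) / (θ - 1) with hKdef
  set L : ℝ := (1 + Real.Gamma (1 - γ) * T ^ γ) * (1 + θ) with hLdef
  have hK : 1 ≤ K := by
    have : 0 < A * (1 + B) / (θ - 1) := by positivity
    linarith
  have hL : 1 ≤ L := one_le_mul_of_one_le_of_one_le
    (by have : 0 < Real.Gamma (1 - γ) * T ^ γ := by positivity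
        linarith) (by linarith)
  refine ⟨K * L, by positivity, ?_⟩
  intro E δ g u gδ α hE hu hv hnoise hθδ _ hα hM
  have hδ : 0 < δ := pos_of_mul_pos_right hθδ (by linarith)
  have hmem : ∀ t ∈ Icc 0 T, MemLp (regularizedHat γ T τ s α gδ t) 2 volume := fun t ht =>
    memLp_regularizedHat hγ0 hγ1 hT hτ hs hα ht.1 gδ
  refine ⟨hmem, fun l hl t ht => ?_⟩
  have hg := fourier_weakSolution hγ0 hγ1 hT hu (right_mem_Icc.2 hT.le)
  rw [hu.final] at hg
  have hut := fourier_weakSolution hγ0 hγ1 hT hu ht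
  have heT := mlSymbol_bounds (n := n) hγ0 hγ1 hT.le
  have hm1 : ∀ η : Rn n, 0 ≤ 1 - mollSymbol τ s α η := fun η =>
    sub_nonneg.2 (mollSymbol_le_one hτ hα η)
  have hq : 0 < α ^ (p + 2) := Real.rpow_pos_of_pos hα _
  -- The rule is used twice: here crudely, to bound δ by E for the summand 1 in 1 + α^(-(p+2)), and
  -- in `hnoise2` with the factor α^(p+2), to bound α^(-(p+2))δ by E.
  have hnoise1 : (θ - 1) * δ ≤ 1 * E := by
    refine noise_le_of_morozov hτ hs hα hδ.le zero_le_one hE.le (continuous_mlSymbol hγ0 T) hg hv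
      hnoise hM fun η => ?_
    rw [one_mul, abs_of_nonneg (mul_nonneg (hm1 η) (heT η).1.le)]
    refine le_trans (mul_le_one₀ ?_ (heT η).1.le (heT η).2.1) (one_le_sobWeight hp.le η)
    linarith [mollSymbol_pos τ s α η]
  have hnoise2 : (θ - 1) * δ ≤ B * α ^ (p + 2) * E := by
    refine noise_le_of_morozov hτ hs hα hδ.le (by positivity) hE.le (continuous_mlSymbol hγ0 T)
      hg hv hnoise hM fun η => ?_
    rw [abs_of_nonneg (mul_nonneg (hm1 η) (heT η).1.le)]
    exact one_sub_mollSymbol_mul_mlSymbol_le hγ0 hγ1 hT hτ hp hps hα η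
  have hstrong : E + A * (1 + (α ^ (p + 2))⁻¹) * δ ≤ K * E := by
    have h1 : δ ≤ E / (θ - 1) := by rw [le_div_iff₀ hθ1]; linarith
    have h2 : (α ^ (p + 2))⁻¹ * δ ≤ B * E / (θ - 1) := by
      rw [inv_mul_le_iff₀ hq, ← mul_div_assoc, le_div_iff₀ hθ1]
      linarith
    calc E + A * (1 + (α ^ (p + 2))⁻¹) * δ = E + A * (δ + (α ^ (p + 2))⁻¹ * δ) := by ring
      _ ≤ E + A * (E / (θ - 1) + B * E / (θ - 1)) := by gcongr
      _ = K * E := by rw [hKdef]; ring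
  have hF := coeFn_fourier_sub_regularizedSolution (hmem t ht) (u t)
  -- Here v̂ is replaced by ĝ/e_T, so the error is (e_t/e_T)(ĝ - m ĝδ).
  have hweak := eLpNorm_error_neg_two_le (t := t)
    (F := (𝓕 (u t - regularizedSolution γ T τ s α gδ t) : L2 n))
    hγ0 hγ1 hT hτ hs hα hδ.le (by linarith) ht.1 hnoise hM (by
      filter_upwards [hF, hut, hg] with η h1 h2 h3
      have h4 : ((mlSymbol γ T η : ℝ) : ℂ) ≠ 0 := Complex.ofReal_ne_zero.2 (heT η).1.ne'
      rw [h1, h2, h3, regularizedHat_eq, ← mlSymbol, ← mlSymbol]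
      push_cast
      field_simp)
  -- The same error, now with m e_t v̂ = m (e_t/e_T) ĝ added and subtracted.
  have hstrong' := (eLpNorm_error_le (T := T)
    (F := (𝓕 (u t - regularizedSolution γ T τ s α gδ t) : L2 n)) hγ0 hγ1 hτ hs hα hδ.le hE.le
    (by positivity) ht.1 hnoise hv (hAb α hα t ht.1) (by
      filter_upwards [hF, hut, hg] with η h1 h2 h3
      have h4 : ((mlSymbol γ T η : ℝ) : ℂ) ≠ 0 := Complex.ofReal_ne_zero.2 (heT η).1.ne'
      rw [h1, h2, h3, regularizedHat_eq, ← mlSymbol, ← mlSymbol]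
      push_cast
      field_simp
      ring)).trans (ENNReal.ofReal_le_ofReal hstrong)
  have hp2 : 0 < p + 2 := by linarith
  have ha : 0 ≤ (2 + l) / (p + 2) := div_nonneg (by linarith [hl.1]) hp2.le
  have hb : 0 ≤ (p - l) / (p + 2) := div_nonneg (by linarith [hl.2]) hp2.le
  have hab : (2 + l) / (p + 2) + (p - l) / (p + 2) = 1 := by field_simp; ring
  rw [sobolevENorm_eq]
  -- The exponents are the solution of a + b = 1 and p a - 2 b = l.
  refine (eLpNorm_sobWeight_interpolation (Lp.aestronglyMeasurable _) ha hb hab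
    (r₁ := p) (r₂ := -2) (by field_simp; ring)).trans ?_
  refine le_trans (mul_le_mul' (ENNReal.rpow_le_rpow hstrong' ha)
    (ENNReal.rpow_le_rpow hweak hb)) ?_
  exact ofReal_rpow_mul_ofReal_rpow_le hK hL hE.le hδ.le ha hb hab
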